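/- Let $s$ be an analytic function on the upper half-plane $\mathbb C_+$ with $|s|\le 1$, $s(i)=0$, and, for all $\alpha\in[0,\pi)$ and $\varepsilon>0$, $z(s(z)-e^{2i\alpha})\to\infty$ as $z\to\infty$ in the sector $\varepsilon\le\arg z\le\pi-\varepsilon$. Let $|\varkappa|<1$ and put $$S(z)=\frac{s(z)-\varkappa}{\overline{\varkappa}\,s(z)-1},\qquad M(z)=\frac1i\cdot\frac{s(z)+1}{s(z)-1},\qquad z\in\mathbb C_+ .$$ Let $\mu$ be the Borel measure on $\mathbb R$ with $\mu(\mathbb R)=\infty$, $\int_{\mathbb R}\frac{d\mu(\lambda)}{1+\lambda^2}=1$ and $$M(z)=\int_{\mathbb R}\Big(\frac1{\lambda-z}-\frac{\lambda}{1+\lambda^2}\Big)d\mu(\lambda),\qquad z\in\mathbb C_+ .$$ In $L^2(\mathbb R;d\mu)$ let $\mathcal B$ be the self-adjoint operator of multiplication by the independent variable on its maximal domain, let $\dot{\mathcal B}$ be its restriction to $\{f\in\mathrm{Dom}(\mathcal B):\int f\,d\mu=0\}$, and let $\widehat{\mathcal B}$ be the restriction of $(\dot{\mathcal B})^*$ to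 $\mathrm{Dom}(\dot{\mathcal B})\dot+\mathrm{span}\{\frac1{\lambda-i}-\varkappa\frac1{\lambda+i}\}$ (the model triple $\mathfrak B=(\dot{\mathcal B},\widehat{\mathcal B},\mathcal B)$). The characteristic function $S_{\mathfrak A}$ of a triple $\mathfrak A=(\dot A,\widehat A,A)$, where $\dot A$ is a densely defined symmetric operator with deficiency indices $(1,1)$, $A$ is a self-adjoint extension of $\dot A$ and $\widehat A\neq\widehat A^*$ is a maximal dissipative extension of $\dot A$, is $$S_{\mathfrak A}(z)=\frac{s_{\mathfrak A}(z)-\varkappa_{\mathfrak A}}{\overline{\varkappa_{\mathfrak A}}\,s_{\mathfrak A}(z)-1},\qquad s_{\mathfrak A}(z)=\frac{z-i}{z+i}\cdot\frac{(g_z,g_-)}{(g_z,g_+)},\qquad z\in\mathbb C_+,$$ where $g_\pm\in\mathrm{Ker}(\dot A^*\mp iI)$, $\|g_\pm\|=1$, $g_+-g_-\in\mathrm{Dom}(A)$, $0\ne g_z\in\mathrm{Ker}(\dot A^*-zI)$, and $\varkappa_{\mathfrak A}$, $|\varkappa_{\mathfrak A}|<1$, is determined by $g_+-\varkappa_{\mathfrak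 A}g_-\in\mathrm{Dom}(\widehat A)$. The Livšic characteristic function of a bounded dissipative operator $T$ whose imaginary part $\Im T=\frac{1}{2i}(T-T^*)$ has rank one is $$S_T(z)=1+2i\,\mathrm{tr}\big[(T^*-zI)^{-1}\,\Im T\big],\qquad z\in\mathbb C_+ .$$ The characteristic function of the model triple is $S_{\mathfrak B}=S$. Assume that $0$ is a quasi-regular point of $\dot{\mathcal B}$, that is, $\|\dot{\mathcal B}f\|\ge k\|f\|$ for some $k>0$ and all $f\in\mathrm{Dom}(\dot{\mathcal B})$. Then $\widehat{\mathcal B}$ has a bounded inverse defined on the whole space, $-\widehat{\mathcal B}^{-1}$ is dissipative with imaginary part of rank one, the boundary value $S_{\mathfrak B}(0+i0)=\lim_{z\to0,\ z\in\mathbb C_+}S_{\mathfrak B}(z)$ exists and is nonzero, and $$S_{-\widehat{\mathcal B}^{-1}}\Big(-\frac1z\Big)=\frac{S_{\mathfrak B}(z)}{S_{\mathfrak B}(0+i0)},\qquad z\in\mathbb C_+ .$$ -/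

import Mathlib

open MeasureTheory Complex
open scoped ComplexStarModule

noncomputable section

/-! ### Unbounded operators in a Hilbert space -/

section Operators

variable {H : Type*} [NormedAddCommGroup H] [InnerProductSpace ℂ H]

/-- `z` is a quasi-regular point (a point of regular type) of `A`: the operator `A - z` is
injective and its inverse is continuous on the range of `A - z`. -/
def IsQuasiRegularPoint (A : H →ₗ.[ℂ] H) (z : ℂ) : Prop :=
  ∃ k : ℝ, 0 < k ∧ ∀ f : A.domain, k * ‖(f : H)‖ ≤ ‖A f - z • (f : H)‖

/-- `T` is the bounded, everywhere defined inverse of `A`: one has `f ∈ Dom A` and `A f = h`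
if and only if `T h = f`. -/
def IsBoundedInverse (A : H →ₗ.[ℂ] H) (T : H →L[ℂ] H) : Prop :=
  ∀ f h : H, (f, h) ∈ A.graph ↔ T h = f

/-- The bounded operator `T` is dissipative: `Im (T f, f) ≥ 0`. (Mathlib's inner product is
linear in the second argument, so `(T f, f)` is `inner ℂ f (T f)`.) -/
def IsBoundedDissipative (T : H →L[ℂ] H) : Prop :=
  ∀ f : H, 0 ≤ (inner ℂ f (T f)).im

/-- The trace of a finite-rank operator, computed on its (finite-dimensional) range. -/
def finiteRankTrace (F : H →L[ℂ] H) : ℂ :=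
  LinearMap.trace ℂ (LinearMap.range (F : H →ₗ[ℂ] H))
    ((F : H →ₗ[ℂ] H).rangeRestrict ∘ₗ (LinearMap.range (F : H →ₗ[ℂ] H)).subtype)

variable [CompleteSpace H]

/-- The Livšic characteristic function of a bounded dissipative operator `T` whose imaginary part
`Im T = (T - T^*) / (2i)` has rank one:
`S_T(z) = 1 + 2i tr [(T^* - z)⁻¹ Im T]`, `Im z > 0`.
(As `T` is dissipative, every such `z` lies in the resolvent set of `T^*`.) -/
def livsicCharacteristicFunction (T : H →L[ℂ] H) (z : ℂ) : ℂ :=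
  1 + 2 * I * finiteRankTrace
    (Ring.inverse (ContinuousLinearMap.adjoint T - z • (1 : H →L[ℂ] H)) * (ℑ T : H →L[ℂ] H))

/-- `g ∈ Ker (A^* - z)`. -/
def IsDeficiencyElement (A : H →ₗ.[ℂ] H) (z : ℂ) (g : H) : Prop :=
  (g, z • g) ∈ A.adjoint.graph

/-- `S` is, on the upper half-plane, the characteristic function of the triple
`(Adot, Ahat, A)`: with normalized deficiency elements `g₊ ∈ Ker (Adot^* - i)`,
`g₋ ∈ Ker (Adot^* + i)` such that `g₊ - g₋ ∈ Dom A`, with the von Neumann parameter `κ`,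
`|κ| < 1`, `g₊ - κ g₋ ∈ Dom Ahat`, and with the Livšic function
`s(z) = (z - i) / (z + i) * (g_z, g₋) / (g_z, g₊)`, `0 ≠ g_z ∈ Ker (Adot^* - z)`, one has
`S(z) = (s(z) - κ) / (conj κ * s(z) - 1)`. -/
def IsTripleCharacteristicFunction (Adot Ahat A : H →ₗ.[ℂ] H) (S : ℂ → ℂ) : Prop :=
  ∃ (gp gm : H) (κ : ℂ),
    IsDeficiencyElement Adot I gp ∧ IsDeficiencyElement Adot (-I) gm ∧
    ‖gp‖ = 1 ∧ ‖gm‖ = 1 ∧ gp - gm ∈ A.domain ∧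
    ‖κ‖ < 1 ∧ gp - κ • gm ∈ Ahat.domain ∧
    ∀ z : ℂ, 0 < z.im → ∃ g : H, g ≠ 0 ∧ IsDeficiencyElement Adot z g ∧
      inner ℂ gp g ≠ 0 ∧
      ∃ s : ℂ, s = (z - I) / (z + I) * (inner ℂ gm g / inner ℂ gp g) ∧
        S z = (s - κ) / ((starRingEnd ℂ) κ * s - 1)

end Operators

/-! ### The model triple -/

/-- The parameters of the functional model. The function `s` is analytic and contractive in the
upper half-plane and satisfies the Livšic criterion, `|κ| < 1`,
`S = (s - κ) / (conj κ * s - 1)`, and `μ` is the infinite Borel measure with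
`∫ dμ(x) / (1 + x²) = 1` which represents the function `M = (1 / i) (s + 1) / (s - 1)`. -/
structure IsModelData (S s : ℂ → ℂ) (κ : ℂ) (μ : Measure ℝ) : Prop where
  analytic : DifferentiableOn ℂ s {z | 0 < z.im}
  contractive : ∀ z : ℂ, 0 < z.im → ‖s z‖ ≤ 1
  livsic_at_I : s I = 0
  livsic_at_infty : ∀ α ∈ Set.Ico (0 : ℝ) Real.pi, ∀ ε : ℝ, 0 < ε →
    Filter.Tendsto (fun z : ℂ => z * (s z - exp (2 * I * α)))
      (Bornology.cobounded ℂ ⊓ Filter.principal {z | ε ≤ arg z ∧ arg z ≤ Real.pi - ε})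
      (Bornology.cobounded ℂ)
  norm_kappa_lt : ‖κ‖ < 1
  S_eq : ∀ z : ℂ, 0 < z.im → S z = (s z - κ) / ((starRingEnd ℂ) κ * s z - 1)
  measure_univ : μ Set.univ = ⊤
  normalized : ∫⁻ x : ℝ, ENNReal.ofReal (1 / (1 + x ^ 2)) ∂μ = 1
  representation : ∀ z : ℂ, 0 < z.im →
    (1 / I) * ((s z + 1) / (s z - 1)) =
      ∫ x : ℝ, (1 / ((x : ℂ) - z) - (x : ℂ) / (1 + (x : ℂ) ^ 2)) ∂μ

/-- The self-adjoint operator of multiplication by the independent variable in `L²(ℝ; μ)`, on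
its maximal domain. -/
def modelB (μ : Measure ℝ) : Lp ℂ 2 μ →ₗ.[ℂ] Lp ℂ 2 μ where
  domain :=
    { carrier := {f | MemLp (fun x : ℝ => (x : ℂ) * f x) 2 μ}
      zero_mem' := by
        refine (memLp_congr_ae ?_).2 (MemLp.zero (ε := ℂ) (p := 2) (μ := μ))
        filter_upwards [Lp.coeFn_zero ℂ 2 μ] with x hx
        have hx' := congrArg (fun w : ℂ => (x : ℂ) * w) hx
        simpa only [Pi.zero_apply, mul_zero] using hx'
      add_mem' := by
        intro f g hf hg
        refine (memLp_congr_ae ?_).2 (MemLp.add hf hg)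
        filter_upwards [Lp.coeFn_add f g] with x hx
        have hx' := congrArg (fun w : ℂ => (x : ℂ) * w) hx
        simpa only [Pi.add_apply, mul_add] using hx'
      smul_mem' := by
        intro c f hf
        refine (memLp_congr_ae ?_).2 (MemLp.const_smul hf c)
        filter_upwards [Lp.coeFn_smul c f] with x hx
        simp [hx, mul_left_comm] }
  toFun :=
    { toFun := fun f => MemLp.toLp (fun x : ℝ => (x : ℂ) * (f : Lp ℂ 2 μ) x) f.2
      map_add' := by
        intro f g
        rw [← MemLp.toLp_add]
        refine MemLp.toLp_congr _ _ ?_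
        filter_upwards [Lp.coeFn_add (f : Lp ℂ 2 μ) (g : Lp ℂ 2 μ)] with x hx
        have hx' := congrArg (fun w : ℂ => (x : ℂ) * w) hx
        simpa only [Pi.add_apply, mul_add, Submodule.coe_add] using hx'
      map_smul' := by
        intro c f
        rw [RingHom.id_apply, ← MemLp.toLp_const_smul]
        refine MemLp.toLp_congr _ _ ?_
        filter_upwards [Lp.coeFn_smul c (f : Lp ℂ 2 μ)] with x hx
        simp [hx, mul_left_comm] }

/-- The functions `f ∈ L²(ℝ; μ)` with `∫ f dμ = 0`. (If `∫ dμ(x) / (1 + x²)` is finite, every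
element of `Dom (modelB μ)` is integrable.) -/
def zeroIntegral (μ : Measure ℝ) : Submodule ℂ (Lp ℂ 2 μ) where
  carrier := {f | Integrable f μ ∧ ∫ x, f x ∂μ = 0}
  zero_mem' := by
    refine ⟨(integrable_zero ℝ ℂ μ).congr (Lp.coeFn_zero ℂ 2 μ).symm, ?_⟩
    rw [integral_congr_ae (Lp.coeFn_zero ℂ 2 μ)]
    simp
  add_mem' := by
    rintro f g ⟨hf, hf0⟩ ⟨hg, hg0⟩
    refine ⟨(hf.add hg).congr (Lp.coeFn_add f g).symm, ?_⟩
    rw [integral_congr_ae (Lp.coeFn_add f g)]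
    simp [integral_add hf hg, hf0, hg0]
  smul_mem' := by
    rintro c f ⟨hf, hf0⟩
    refine ⟨(hf.smul c).congr (Lp.coeFn_smul c f).symm, ?_⟩
    rw [integral_congr_ae (Lp.coeFn_smul c f)]
    simp [integral_const_mul, hf0]

/-- The symmetric restriction of `modelB μ` to the functions with `∫ f dμ = 0`. -/
def modelBdot (μ : Measure ℝ) : Lp ℂ 2 μ →ₗ.[ℂ] Lp ℂ 2 μ :=
  (modelB μ).domRestrict (zeroIntegral μ)

/-- The dissipative quasi-self-adjoint extension of `modelBdot μ`: the restriction of the adjoint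
of `modelBdot μ` to `Dom (modelBdot μ) + span {1 / (x - i) - κ / (x + i)}`. -/
def modelBhat (μ : Measure ℝ) (κ : ℂ) : Lp ℂ 2 μ →ₗ.[ℂ] Lp ℂ 2 μ :=
  (modelBdot μ).adjoint.domRestrict
    ((modelBdot μ).domain ⊔
      Submodule.span ℂ {f : Lp ℂ 2 μ |
        f =ᵐ[μ] fun x : ℝ => 1 / ((x : ℂ) - I) - κ * (1 / ((x : ℂ) + I))})

end

/-!
The adjoint of `Ḃ` consists of the pairs `(g, x g - c)`, and the boundary values `Γ₀ = c` and
`Γ₁ = ∫ (g - c x / (1 + x²)) dμ` form a boundary triple for it: Green's identity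
`(u, A v) - (A u, v) = conj (Γ₀ u) Γ₁ v - conj (Γ₁ u) Γ₀ v` holds, and the defect element
`1 / (x - z)` satisfies `Γ₁ = M(z) Γ₀`. The operator `B̂` is the extension given by the boundary
condition `Γ₁ = m Γ₀` with `m = i (1 + κ) / (1 - κ)`, so `Im m > 0`, and `S(z)` is a constant
multiple of `(M(z) - m) / (M(z) - conj m)`.

If `0` is quasi-regular, the range of every such extension is closed, being a one-dimensional
extension of the range of `Ḃ`; it is everything since the adjoint extension, with parameter
`conj m`, is injective. Green's identity then gives the imaginary part of `-T`, `T = B̂⁻¹`, as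
`Im m` times the rank-one operator `x ↦ (φ, x) φ` with `φ` in the kernel of the adjoint,
and shows that the Livšic function of `-T` at `-1 / z` is also a constant multiple of
`(M(z) - m) / (M(z) - conj m)`. The Livšic function of a bounded operator tends to `1` at infinity,
and `-1 / z` tends to infinity as `z` tends to `0`; this identifies the ratio of the two constants
as the boundary value of `S` at `0`.
-/

section RankOneImaginaryPart

open InnerProductSpace ContinuousLinearMap
open scoped ComplexConjugate

theorem ringInverse_neg {R : Type*} [Ring R] (a : R) : Ring.inverse (-a) = -Ring.inverse a := by
  rw [← neg_one_mul, Ring.mul_inverse_rev' (Commute.neg_one_left a), ← Units.val_one,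
    ← Units.val_neg, Ring.inverse_unit]
  simp

variable {H : Type*} [NormedAddCommGroup H] [InnerProductSpace ℂ H]

theorem finiteRankTrace_rankOne (ψ φ : H) :
    finiteRankTrace (rankOne ℂ ψ φ) = inner ℂ φ ψ := by
  obtain rfl | hφ := eq_or_ne φ 0
  · have h_zero : (rankOne ℂ ψ (0 : H) : H →ₗ[ℂ] H).rangeRestrict = 0 := by
      ext x
      simp
    rw [finiteRankTrace, h_zero, LinearMap.zero_comp, map_zero, inner_zero_left]
  have h_finite : FiniteDimensional ℂ (LinearMap.range (rankOne ℂ ψ φ : H →ₗ[ℂ] H)) := by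
    refine Submodule.finiteDimensional_of_le (S₂ := Submodule.span ℂ {ψ}) ?_
    rintro _ ⟨x, rfl⟩
    exact Submodule.smul_mem _ _ (Submodule.mem_span_singleton_self ψ)
  have hψ : ψ ∈ LinearMap.range (rankOne ℂ ψ φ : H →ₗ[ℂ] H) := by
    refine ⟨(inner ℂ φ φ)⁻¹ • φ, ?_⟩
    rw [coe_coe, rankOne_apply, inner_smul_right,
      inv_mul_cancel₀ (inner_self_ne_zero.2 hφ), one_smul]
  let a : ℂ →ₗ[ℂ] LinearMap.range (rankOne ℂ ψ φ : H →ₗ[ℂ] H) :=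
    LinearMap.toSpanSingleton ℂ _ ⟨ψ, hψ⟩
  let b : LinearMap.range (rankOne ℂ ψ φ : H →ₗ[ℂ] H) →ₗ[ℂ] ℂ :=
    (innerSL ℂ φ).toLinearMap ∘ₗ Submodule.subtype _
  have hab : (rankOne ℂ ψ φ : H →ₗ[ℂ] H).rangeRestrict ∘ₗ Submodule.subtype _ = a ∘ₗ b := by
    ext x
    simp [a, b]
  have hba : b ∘ₗ a = inner ℂ φ ψ • LinearMap.id := by
    ext
    simp [a, b]
  rw [finiteRankTrace, hab, LinearMap.trace_comp_comm', hba, map_smul, LinearMap.trace_id,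
    Module.finrank_self, Nat.cast_one, smul_eq_mul, mul_one]

theorem finrank_range_rankOne {ψ φ : H} (hψ : ψ ≠ 0) (hφ : φ ≠ 0) :
    Module.finrank ℂ (LinearMap.range (rankOne ℂ ψ φ : H →ₗ[ℂ] H)) = 1 :=
  Module.rank_eq_one_iff_finrank_eq_one.1 (rank_rankOne hψ hφ)

variable [CompleteSpace H]

theorem inner_imaginaryPart_apply (A : H →L[ℂ] H) (x y : H) :
    inner ℂ y ((ℑ A : H →L[ℂ] H) x) = (2 * I)⁻¹ * (inner ℂ y (A x) - inner ℂ (A y) x) := by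
  rw [imaginaryPart_apply_coe, star_eq_adjoint, smul_apply, smul_apply, sub_apply,
    inner_smul_right, ← Complex.coe_smul (2 : ℝ)⁻¹, inner_smul_right, inner_sub_right,
    adjoint_inner_right, mul_inv, Complex.inv_I]
  push_cast
  ring

theorem IsBoundedDissipative.isUnit_adjoint_sub {A : H →L[ℂ] H} (hA : IsBoundedDissipative A)
    {w : ℂ} (hw : 0 < w.im) : IsUnit (adjoint A - w • (1 : H →L[ℂ] H)) := by
  refine isUnit_of_forall_le_norm_inner_map _ (c := ⟨w.im, hw.le⟩) (by exact_mod_cast hw)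
    fun x => ?_
  have h_inner : inner ℂ ((adjoint A - w • (1 : H →L[ℂ] H)) x) x =
      inner ℂ x (A x) - conj w * ((‖x‖ ^ 2 : ℝ) : ℂ) := by
    simp [adjoint_inner_left, inner_self_eq_norm_sq_to_K, mul_comm]
  rw [h_inner]
  calc ‖x‖ ^ 2 * w.im
      ≤ (inner ℂ x (A x)).im + ‖x‖ ^ 2 * w.im := le_add_of_nonneg_left (hA x)
    _ = (inner ℂ x (A x) - conj w * ((‖x‖ ^ 2 : ℝ) : ℂ)).im := by
        rw [Complex.sub_im, Complex.im_mul_ofReal, Complex.conj_im]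
        ring
    _ ≤ ‖inner ℂ x (A x) - conj w * ((‖x‖ ^ 2 : ℝ) : ℂ)‖ :=
        (le_abs_self _).trans (Complex.abs_im_le_norm _)

variable {A : H →L[ℂ] H} {c : ℂ} {φ : H}

theorem livsicCharacteristicFunction_of_imaginaryPart_eq
    (hA : (ℑ A : H →L[ℂ] H) = c • rankOne ℂ φ φ) (w : ℂ) :
    livsicCharacteristicFunction A w =
      1 + 2 * I * c * inner ℂ φ (Ring.inverse (adjoint A - w • (1 : H →L[ℂ] H)) φ) := by
  have h_mul (B : H →L[ℂ] H) : B * (c • rankOne ℂ φ φ) = rankOne ℂ (c • B φ) φ := by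
    ext x
    simp [smul_comm c]
  rw [livsicCharacteristicFunction, hA, h_mul, finiteRankTrace_rankOne, inner_smul_right,
    mul_assoc (2 * I)]

theorem tendsto_livsicCharacteristicFunction_cobounded
    (hA : (ℑ A : H →L[ℂ] H) = c • rankOne ℂ φ φ) :
    Filter.Tendsto (livsicCharacteristicFunction A) (Bornology.cobounded ℂ) (nhds 1) := by
  have h_resolvent (w : ℂ) :
      Ring.inverse (adjoint A - w • (1 : H →L[ℂ] H)) = -resolvent (adjoint A) w := by
    rw [resolvent, Algebra.algebraMap_eq_smul_one, ← neg_sub (w • (1 : H →L[ℂ] H))]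
    exact ringInverse_neg _
  have h_cont : Continuous fun B : H →L[ℂ] H => 1 + 2 * I * c * inner ℂ φ ((-B) φ) := by fun_prop
  have h_lim := (h_cont.tendsto 0).comp
    (spectrum.resolvent_tendsto_cobounded (𝕜 := ℂ) (adjoint A))
  simp only [neg_zero, zero_apply, inner_zero_right, mul_zero, add_zero] at h_lim
  refine h_lim.congr fun w => ?_
  rw [livsicCharacteristicFunction_of_imaginaryPart_eq hA, h_resolvent, Function.comp_apply]

end RankOneImaginaryPart

section LinearRelations

theorem isClosed_adjoint {𝕜 E F : Type*} [RCLike 𝕜] [NormedAddCommGroup E] [InnerProductSpace 𝕜 E]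
    [NormedAddCommGroup F] [InnerProductSpace 𝕜 F] (R : Submodule 𝕜 (E × F)) :
    IsClosed (R.adjoint : Set (F × E)) := by
  rw [Submodule.adjoint, Submodule.map_coe]
  exact (LinearEquiv.image_eq_preimage_symm (WithLp.linearEquiv 2 𝕜 (F × E)) _).symm ▸
    (Submodule.isClosed_orthogonal _).preimage (WithLp.prod_continuous_toLp _ _ _)

theorem graph_domRestrict_map_fst {R E F : Type*} [Ring R] [AddCommGroup E] [Module R E]
    [AddCommGroup F] [Module R F] {B : E →ₗ.[R] F} {N : Submodule R (E × F)} (hN : N ≤ B.graph) :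
    (B.domRestrict (N.map (LinearMap.fst R E F))).graph = N := by
  have h_le : (B.domRestrict (N.map (LinearMap.fst R E F))).graph ≤ B.graph :=
    LinearPMap.le_graph_of_le LinearPMap.domRestrict_le
  have h_mem {u : E × F} (hu : u ∈ N) :
      u.1 ∈ (B.domRestrict (N.map (LinearMap.fst R E F))).domain :=
    ⟨⟨u, hu, rfl⟩, LinearPMap.mem_domain_of_mem_graph (hN hu)⟩
  ext u
  constructor
  · intro hu
    obtain ⟨v, hv, hvu⟩ := (LinearPMap.mem_domain_of_mem_graph hu).1
    have h_snd : v.2 = u.2 := LinearPMap.mem_graph_snd_inj' B (hN hv) (h_le hu) hvu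
    exact Prod.ext hvu h_snd ▸ hv
  · intro hu
    obtain ⟨y, hy⟩ := LinearPMap.mem_domain_iff.1 (h_mem hu)
    have h_snd : y = u.2 := LinearPMap.mem_graph_snd_inj' B (h_le hy) (hN hu) rfl
    exact (Prod.ext rfl h_snd : (u.1, y) = u) ▸ hy

variable {𝕜 E F : Type*} [NontriviallyNormedField 𝕜] [NormedAddCommGroup E] [NormedSpace 𝕜 E]
  [NormedAddCommGroup F] [NormedSpace 𝕜 F]

/-- The bounded operator `T : F → E` is the inverse of the linear relation `R`, a subspace of
`E × F` viewed as the graph of a multivalued operator from `E` to `F`. For `R = A.graph` this is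
`IsBoundedInverse A T`. -/
def IsRelationInverse (R : Submodule 𝕜 (E × F)) (T : F →L[𝕜] E) : Prop :=
  ∀ g h, (g, h) ∈ R ↔ T h = g

theorem IsRelationInverse.mem {R : Submodule 𝕜 (E × F)} {T : F →L[𝕜] E}
    (hT : IsRelationInverse R T) (h : F) : (T h, h) ∈ R :=
  (hT _ _).2 rfl

theorem isClosed_map_snd [CompleteSpace E] [CompleteSpace F] {R : Submodule 𝕜 (E × F)}
    (hR : IsClosed (R : Set (E × F))) {k : ℝ} (hk : 0 < k) (hbound : ∀ u ∈ R, k * ‖u.1‖ ≤ ‖u.2‖) :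
    IsClosed (R.map (LinearMap.snd 𝕜 E F) : Set F) := by
  have : CompleteSpace R := hR.completeSpace_coe
  let L : R →L[𝕜] F := (ContinuousLinearMap.snd 𝕜 E F).comp R.subtypeL
  have h_anti : AntilipschitzWith (max k⁻¹ 1).toNNReal L := by
    refine L.antilipschitz_of_bound fun u => ?_
    rw [Real.coe_toNNReal _ (le_max_of_le_right zero_le_one), max_mul_of_nonneg _ _ (norm_nonneg _),
      one_mul]
    exact max_le_max_right _ ((le_inv_mul_iff₀ hk).2 (hbound u u.2))
  have h_range : Set.range L = (R.map (LinearMap.snd 𝕜 E F) : Set F) := by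
    ext y
    simp [L]
  exact h_range ▸ h_anti.isClosed_range L.uniformContinuous

theorem exists_isRelationInverse_of_isClosed [CompleteSpace E] [CompleteSpace F]
    {R : Submodule 𝕜 (E × F)} (hR : IsClosed (R : Set (E × F))) (h_inj : ∀ u ∈ R, u.2 = 0 → u = 0)
    (h_surj : R.map (LinearMap.snd 𝕜 E F) = ⊤) :
    ∃ T : F →L[𝕜] E, IsRelationInverse R T := by
  have : CompleteSpace R := hR.completeSpace_coe
  let L : R →L[𝕜] F := (ContinuousLinearMap.snd 𝕜 E F).comp R.subtypeL
  have h_ker : L.ker = ⊥ :=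
    LinearMap.ker_eq_bot'.2 fun u hu => Subtype.ext (h_inj u u.2 hu)
  have h_range : L.range = ⊤ := by
    rw [← h_surj]
    ext y
    simp [L]
  let e := ContinuousLinearEquiv.ofBijective L h_ker h_range
  have he (u : R) : e u = (u : E × F).2 := rfl
  refine ⟨(ContinuousLinearMap.fst 𝕜 E F).comp (R.subtypeL.comp (e.symm : F →L[𝕜] R)),
    fun g h => ⟨fun hgh => ?_, fun hgh => ?_⟩⟩
  · exact congrArg (fun u : R => (u : E × F).1) (e.symm_apply_apply ⟨(g, h), hgh⟩)
  · have h_pair : (e.symm h : E × F) = (g, h) :=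
      Prod.ext hgh (by rw [← he, e.apply_symm_apply])
    exact h_pair ▸ (e.symm h).2

theorem IsRelationInverse.adjoint {𝕜 E F : Type*} [RCLike 𝕜] [NormedAddCommGroup E]
    [InnerProductSpace 𝕜 E] [CompleteSpace E] [NormedAddCommGroup F] [InnerProductSpace 𝕜 F]
    [CompleteSpace F] {R : Submodule 𝕜 (E × F)} {T : F →L[𝕜] E} (hT : IsRelationInverse R T) :
    IsRelationInverse R.adjoint (ContinuousLinearMap.adjoint T) := by
  intro g h
  rw [Submodule.mem_adjoint_iff]
  constructor
  · refine fun hgh => ext_inner_left 𝕜 fun y => ?_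
    rw [ContinuousLinearMap.adjoint_inner_right, ← sub_eq_zero.1 (hgh _ _ (hT.mem y))]
  · rintro rfl a b hab
    rw [ContinuousLinearMap.adjoint_inner_right, (hT a b).1 hab, sub_self]

end LinearRelations

section BoundaryTriples

open InnerProductSpace
open scoped ComplexConjugate

variable {H : Type*} [NormedAddCommGroup H] [InnerProductSpace ℂ H]

/-- The elements of the relation `G` on which both boundary functionals vanish. When `G` is the
adjoint of a closed symmetric operator and `Γ₀`, `Γ₁` are its boundary values, this is the graph of
the symmetric operator. -/
noncomputable def minimalRelation (G : Submodule ℂ (H × H)) (Γ₀ Γ₁ : H × H →L[ℂ] ℂ) :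
    Submodule ℂ (H × H) :=
  G ⊓ (Γ₀.ker ⊓ Γ₁.ker)

/-- The restriction of the relation `G` by the boundary condition `Γ₁ u = m * Γ₀ u`. -/
noncomputable def boundaryExtension (G : Submodule ℂ (H × H)) (Γ₀ Γ₁ : H × H →L[ℂ] ℂ) (m : ℂ) :
    Submodule ℂ (H × H) :=
  G ⊓ (Γ₁ - m • Γ₀).ker

/-- A boundary triple with boundary space `ℂ`: the relation `G` is the adjoint of the symmetric
relation `minimalRelation G Γ₀ Γ₁`, whose deficiency indices are `(1, 1)`, and `Γ₀`, `Γ₁` are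
boundary values for which Green's identity holds. -/
structure IsBoundaryTriple (G : Submodule ℂ (H × H)) (Γ₀ Γ₁ : H × H →L[ℂ] ℂ) : Prop where
  green : ∀ u ∈ G, ∀ v ∈ G, inner ℂ u.1 v.2 - inner ℂ u.2 v.1 =
    conj (Γ₀ u) * Γ₁ v - conj (Γ₁ u) * Γ₀ v
  surjective : ∀ a b : ℂ, ∃ u ∈ G, Γ₀ u = a ∧ Γ₁ u = b
  adjoint_le : (minimalRelation G Γ₀ Γ₁).adjoint ≤ G

/-- An element `φ` of the kernel of `G`, normalized so that `⟨φ, u.2⟩ = Γ₀ u` on the extension with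
boundary condition `Γ₁ u = m * Γ₀ u`. -/
structure IsKernelVector (G : Submodule ℂ (H × H)) (Γ₀ Γ₁ : H × H →L[ℂ] ℂ) (m : ℂ) (φ : H) :
    Prop where
  mem : (φ, 0) ∈ G
  normalized : Γ₁ (φ, 0) = conj m * Γ₀ (φ, 0) - 1

variable {G : Submodule ℂ (H × H)} {Γ₀ Γ₁ : H × H →L[ℂ] ℂ} {m : ℂ} {u : H × H} {φ : H}
  {T : H →L[ℂ] H}

theorem mem_minimalRelation :
    u ∈ minimalRelation G Γ₀ Γ₁ ↔ u ∈ G ∧ Γ₀ u = 0 ∧ Γ₁ u = 0 :=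
  Iff.rfl

theorem mem_boundaryExtension :
    u ∈ boundaryExtension G Γ₀ Γ₁ m ↔ u ∈ G ∧ Γ₁ u = m * Γ₀ u := by
  simp [boundaryExtension, sub_eq_zero]

theorem minimalRelation_le_boundaryExtension :
    minimalRelation G Γ₀ Γ₁ ≤ boundaryExtension G Γ₀ Γ₁ m := by
  intro u hu
  obtain ⟨huG, hu₀, hu₁⟩ := mem_minimalRelation.1 hu
  exact mem_boundaryExtension.2 ⟨huG, by rw [hu₀, hu₁, mul_zero]⟩

theorem boundaryExtension_eq_sup_span {e : H × H} (he : e ∈ boundaryExtension G Γ₀ Γ₁ m)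
    (he₀ : Γ₀ e ≠ 0) :
    boundaryExtension G Γ₀ Γ₁ m = minimalRelation G Γ₀ Γ₁ ⊔ Submodule.span ℂ {e} := by
  refine le_antisymm (fun u hu => ?_) (sup_le minimalRelation_le_boundaryExtension
    ((Submodule.span_singleton_le_iff_mem _ _).2 he))
  set a := Γ₀ u / Γ₀ e
  have h_diff := Submodule.sub_mem _ hu (Submodule.smul_mem _ a he)
  have h_diff₀ : Γ₀ (u - a • e) = 0 := by
    rw [map_sub, map_smul, smul_eq_mul, div_mul_cancel₀ _ he₀, sub_self]
  rw [mem_boundaryExtension, h_diff₀, mul_zero] at h_diff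
  exact Submodule.mem_sup.2 ⟨u - a • e, ⟨h_diff.1, h_diff₀, h_diff.2⟩, a • e,
    Submodule.smul_mem _ _ (Submodule.mem_span_singleton_self e), sub_add_cancel _ _⟩

theorem IsKernelVector.ne_zero (hφ : IsKernelVector G Γ₀ Γ₁ m φ) : φ ≠ 0 := by
  rintro rfl
  have h_normalized := hφ.normalized
  rw [Prod.mk_zero_zero, map_zero, map_zero, mul_zero, zero_sub] at h_normalized
  exact neg_ne_zero.2 one_ne_zero h_normalized.symm

namespace IsBoundaryTriple

theorem isClosed (hG : IsBoundaryTriple G Γ₀ Γ₁) : IsClosed (G : Set (H × H)) := by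
  have h_le : G ≤ (minimalRelation G Γ₀ Γ₁).adjoint := by
    intro v hv
    rw [Submodule.mem_adjoint_iff]
    intro a b hab
    obtain ⟨habG, hab₀, hab₁⟩ := mem_minimalRelation.1 hab
    have h_green := hG.green _ habG v hv
    rw [hab₀, hab₁, map_zero, zero_mul, zero_mul, sub_zero] at h_green
    rw [← neg_sub, h_green, neg_zero]
  exact le_antisymm h_le hG.adjoint_le ▸ isClosed_adjoint _

theorem adjoint_boundaryExtension (hG : IsBoundaryTriple G Γ₀ Γ₁) (m : ℂ) :
    (boundaryExtension G Γ₀ Γ₁ m).adjoint =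
      boundaryExtension G Γ₀ Γ₁ (conj m) := by
  ext v
  rw [mem_boundaryExtension, Submodule.mem_adjoint_iff]
  constructor
  · intro hv
    have hvG : v ∈ G := hG.adjoint_le <| (Submodule.mem_adjoint_iff _ _).2 fun a b hab =>
      hv a b (minimalRelation_le_boundaryExtension hab)
    obtain ⟨e, heG, he₀, he₁⟩ := hG.surjective 1 m
    have h_green := hG.green e heG v hvG
    rw [← neg_sub, hv e.1 e.2 (mem_boundaryExtension.2 ⟨heG, by rw [he₀, he₁, mul_one]⟩),
      he₀, he₁, map_one, one_mul, neg_zero] at h_green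
    exact ⟨hvG, (sub_eq_zero.1 h_green.symm)⟩
  · rintro ⟨hvG, hv⟩ a b hab
    obtain ⟨habG, hab⟩ := mem_boundaryExtension.1 hab
    have h_green := hG.green _ habG v hvG
    rw [hab, hv, map_mul] at h_green
    linear_combination -h_green

theorem im_inner_eq (hG : IsBoundaryTriple G Γ₀ Γ₁) (hu : u ∈ boundaryExtension G Γ₀ Γ₁ m) :
    (inner ℂ u.1 u.2).im = m.im * normSq (Γ₀ u) := by
  obtain ⟨huG, hu⟩ := mem_boundaryExtension.1 hu
  have h_green := hG.green u huG u huG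
  rw [← inner_conj_symm u.2, sub_conj, hu, map_mul] at h_green
  have h_conj : conj (Γ₀ u) * (m * Γ₀ u) - conj m * conj (Γ₀ u) *
      Γ₀ u = ((2 * (m.im * normSq (Γ₀ u)) : ℝ) : ℂ) * I := by
    have := sub_conj m
    push_cast at this ⊢
    linear_combination (Γ₀ u * conj (Γ₀ u)) * this + 2 * m.im * I * mul_conj (Γ₀ u)
  rw [h_conj] at h_green
  have := ofReal_injective (mul_right_cancel₀ I_ne_zero h_green)
  linarith

theorem eq_zero_of_snd_eq_zero (hG : IsBoundaryTriple G Γ₀ Γ₁) {k : ℝ} (hk : 0 < k)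
    (hreg : ∀ u ∈ minimalRelation G Γ₀ Γ₁, k * ‖u.1‖ ≤ ‖u.2‖) (hm : m.im ≠ 0)
    (hu : u ∈ boundaryExtension G Γ₀ Γ₁ m) (hu2 : u.2 = 0) : u = 0 := by
  have h_im := hG.im_inner_eq hu
  rw [hu2, inner_zero_right, zero_im, zero_eq_mul, or_iff_right hm, normSq_eq_zero] at h_im
  obtain ⟨huG, hu⟩ := mem_boundaryExtension.1 hu
  have h_le := hreg u ⟨huG, h_im, show Γ₁ u = 0 by rw [hu, h_im, mul_zero]⟩
  rw [hu2, norm_zero] at h_le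
  have h_fst : u.1 = 0 := norm_le_zero_iff.1 (nonpos_of_mul_nonpos_right h_le hk)
  exact Prod.ext h_fst hu2

theorem inner_kernel_vector (hG : IsBoundaryTriple G Γ₀ Γ₁)
    (hφ : IsKernelVector G Γ₀ Γ₁ m φ) (hu : u ∈ boundaryExtension G Γ₀ Γ₁ m) :
    inner ℂ φ u.2 = Γ₀ u := by
  obtain ⟨huG, hu⟩ := mem_boundaryExtension.1 hu
  have h_green := hG.green _ hφ.mem u huG
  rw [hφ.normalized, hu, map_sub, map_mul, conj_conj, map_one, inner_zero_left] at h_green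
  linear_combination h_green

theorem im_pos_and_boundaryValue_ne_zero (hG : IsBoundaryTriple G Γ₀ Γ₁) {z M : ℂ} {g : H}
    (hz : 0 < z.im) (hg : g ≠ 0) (hgM : (g, z • g) ∈ boundaryExtension G Γ₀ Γ₁ M) :
    0 < M.im ∧ Γ₀ (g, z • g) ≠ 0 := by
  have h_im := hG.im_inner_eq hgM
  have h_inner : inner ℂ g (z • g) = z * (‖g‖ ^ 2 : ℝ) := by
    simp [inner_self_eq_norm_sq_to_K]
  rw [h_inner, im_mul_ofReal] at h_im
  have h_pos : 0 < M.im * normSq (Γ₀ (g, z • g)) := h_im ▸ by positivity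
  exact ⟨pos_of_mul_pos_left h_pos (normSq_nonneg _), fun h => by simp [h] at h_pos⟩

theorem isBoundedDissipative_neg (hG : IsBoundaryTriple G Γ₀ Γ₁)
    (hT : IsRelationInverse (boundaryExtension G Γ₀ Γ₁ m) T) (hm : 0 ≤ m.im) :
    IsBoundedDissipative (-T) := by
  intro f
  rw [neg_apply, inner_neg_right, ← inner_conj_symm, ← map_neg, conj_im, neg_im, neg_neg,
    hG.im_inner_eq (hT.mem f)]
  exact mul_nonneg hm (normSq_nonneg _)

variable [CompleteSpace H]

theorem isClosed_map_snd_boundaryExtension (hG : IsBoundaryTriple G Γ₀ Γ₁) {k : ℝ} (hk : 0 < k)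
    (hreg : ∀ u ∈ minimalRelation G Γ₀ Γ₁, k * ‖u.1‖ ≤ ‖u.2‖) (m : ℂ) :
    IsClosed ((boundaryExtension G Γ₀ Γ₁ m).map (LinearMap.snd ℂ H H) : Set H) := by
  obtain ⟨e, heG, he₀, he₁⟩ := hG.surjective 1 m
  have he : e ∈ boundaryExtension G Γ₀ Γ₁ m :=
    mem_boundaryExtension.2 ⟨heG, by rw [he₀, he₁, mul_one]⟩
  have h_min : IsClosed (minimalRelation G Γ₀ Γ₁ : Set (H × H)) :=
    hG.isClosed.inter (Γ₀.isClosed_ker.inter Γ₁.isClosed_ker)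
  rw [boundaryExtension_eq_sup_span he (he₀ ▸ one_ne_zero), Submodule.map_sup, Submodule.map_span,
    Set.image_singleton]
  exact Submodule.isClosed_sup_finiteDimensional _ _ (isClosed_map_snd h_min hk hreg)

theorem map_snd_boundaryExtension (hG : IsBoundaryTriple G Γ₀ Γ₁) {k : ℝ} (hk : 0 < k)
    (hreg : ∀ u ∈ minimalRelation G Γ₀ Γ₁, k * ‖u.1‖ ≤ ‖u.2‖) (hm : m.im ≠ 0) :
    (boundaryExtension G Γ₀ Γ₁ m).map (LinearMap.snd ℂ H H) = ⊤ := by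
  have := (hG.isClosed_map_snd_boundaryExtension hk hreg m).completeSpace_coe
  rw [← Submodule.orthogonal_eq_bot_iff, Submodule.eq_bot_iff]
  intro p hp
  have hp_mem : (p, (0 : H)) ∈ boundaryExtension G Γ₀ Γ₁ (conj m) := by
    rw [← hG.adjoint_boundaryExtension, Submodule.mem_adjoint_iff]
    intro a b hab
    rw [inner_zero_right, sub_zero]
    exact hp b ⟨(a, b), hab, rfl⟩
  exact congrArg Prod.fst
    (hG.eq_zero_of_snd_eq_zero hk hreg (by rwa [conj_im, neg_ne_zero]) hp_mem rfl)

theorem exists_isRelationInverse (hG : IsBoundaryTriple G Γ₀ Γ₁) {k : ℝ} (hk : 0 < k)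
    (hreg : ∀ u ∈ minimalRelation G Γ₀ Γ₁, k * ‖u.1‖ ≤ ‖u.2‖) (hm : m.im ≠ 0) :
    ∃ T : H →L[ℂ] H, IsRelationInverse (boundaryExtension G Γ₀ Γ₁ m) T :=
  exists_isRelationInverse_of_isClosed
    (hG.isClosed.inter (Γ₁ - m • Γ₀).isClosed_ker)
    (fun _ hu hu2 => hG.eq_zero_of_snd_eq_zero hk hreg hm hu hu2)
    (hG.map_snd_boundaryExtension hk hreg hm)

theorem exists_isKernelVector (hG : IsBoundaryTriple G Γ₀ Γ₁)
    (hT : IsRelationInverse (boundaryExtension G Γ₀ Γ₁ m) T) :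
    ∃ φ : H, IsKernelVector G Γ₀ Γ₁ m φ := by
  have hT' := hT.adjoint
  rw [hG.adjoint_boundaryExtension] at hT'
  obtain ⟨e, heG, he₀, he₁⟩ := hG.surjective 0 (-1)
  obtain ⟨hvG, hv⟩ := mem_boundaryExtension.1 (hT'.mem e.2)
  set v := (ContinuousLinearMap.adjoint T e.2, e.2)
  have h_pair : (e.1 - v.1, (0 : H)) = e - v := Prod.ext rfl (sub_self e.2).symm
  refine ⟨e.1 - v.1, h_pair ▸ G.sub_mem heG hvG, ?_⟩
  rw [h_pair, map_sub, map_sub, he₀, he₁, hv]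
  ring

theorem imaginaryPart_neg_eq_smul_rankOne (hG : IsBoundaryTriple G Γ₀ Γ₁)
    (hT : IsRelationInverse (boundaryExtension G Γ₀ Γ₁ m) T) (hφ : IsKernelVector G Γ₀ Γ₁ m φ) :
    (ℑ (-T) : H →L[ℂ] H) = (m.im : ℂ) • rankOne ℂ φ φ := by
  refine ContinuousLinearMap.ext fun x => ext_inner_left ℂ fun y => ?_
  obtain ⟨hxG, hx⟩ := mem_boundaryExtension.1 (hT.mem x)
  obtain ⟨hyG, hy⟩ := mem_boundaryExtension.1 (hT.mem y)
  have h_green := hG.green _ hyG _ hxG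
  rw [hx, hy, ← hG.inner_kernel_vector hφ (hT.mem x),
    ← hG.inner_kernel_vector hφ (hT.mem y), map_mul, inner_conj_symm] at h_green
  have h_im := sub_conj m
  have h_I : (2 * I)⁻¹ * (2 * I) = 1 := inv_mul_cancel₀ (by simp)
  rw [inner_imaginaryPart_apply, neg_apply, neg_apply, inner_neg_left, inner_neg_right,
    smul_apply, rankOne_apply, inner_smul_right, inner_smul_right]
  push_cast at h_im
  simp only at h_green
  linear_combination (2 * I)⁻¹ * h_green +
    (2 * I)⁻¹ * inner ℂ y φ * inner ℂ φ x * h_im + m.im * inner ℂ y φ * inner ℂ φ x * h_I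

theorem ringInverse_adjoint_neg_apply_kernel_vector (hG : IsBoundaryTriple G Γ₀ Γ₁)
    (hm : 0 < m.im) (hT : IsRelationInverse (boundaryExtension G Γ₀ Γ₁ m) T)
    (hφ : IsKernelVector G Γ₀ Γ₁ m φ) {z : ℂ} {g : H} (hz : 0 < z.im)
    (hgG : (g, z • g) ∈ G)
    (hg : Γ₁ (g, z • g) = conj m * Γ₀ (g, z • g) - 1) :
    Ring.inverse (ContinuousLinearMap.adjoint (-T) - (-1 / z) • (1 : H →L[ℂ] H)) φ = z • g := by
  have hz0 : z ≠ 0 := by rintro rfl; simp at hz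
  have hw : 0 < (-1 / z).im := by
    rw [neg_div, one_div, neg_im, inv_im, neg_div, neg_neg]
    exact div_pos hz (normSq_pos.2 hz0)
  have h_unit := (hG.isBoundedDissipative_neg hT hm.le).isUnit_adjoint_sub hw
  have hT' := hT.adjoint
  rw [hG.adjoint_boundaryExtension] at hT'
  have h_mem : (g - φ, z • g) ∈ boundaryExtension G Γ₀ Γ₁ (conj m) := by
    have h_pair : (g - φ, z • g) = (g, z • g) - (φ, 0) := Prod.ext rfl (sub_zero _).symm
    rw [h_pair, mem_boundaryExtension, map_sub, map_sub, hg, hφ.normalized]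
    exact ⟨G.sub_mem hgG hφ.mem, by ring⟩
  have h_apply : (ContinuousLinearMap.adjoint (-T) - (-1 / z) • (1 : H →L[ℂ] H)) (z • g) = φ := by
    rw [map_neg, sub_apply, neg_apply, (hT' _ _).1 h_mem, smul_apply, one_apply_eq_self, smul_smul,
      div_mul_cancel₀ _ hz0, neg_one_smul]
    abel
  rw [← h_apply, ← mul_apply_eq_comp, Ring.inverse_mul_cancel _ h_unit, one_apply_eq_self]

theorem livsicCharacteristicFunction_neg_inverse (hG : IsBoundaryTriple G Γ₀ Γ₁) (hm : 0 < m.im)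
    (hT : IsRelationInverse (boundaryExtension G Γ₀ Γ₁ m) T)
    (hφ : IsKernelVector G Γ₀ Γ₁ m φ) {z M : ℂ} {g : H} (hz : 0 < z.im)
    (hg : g ≠ 0) (hgM : (g, z • g) ∈ boundaryExtension G Γ₀ Γ₁ M) :
    livsicCharacteristicFunction (-T) (-1 / z) =
      (1 - (m - conj m) * conj (Γ₀ (φ, 0))) *
        ((M - m) / (M - conj m)) := by
  obtain ⟨hM, hb⟩ := hG.im_pos_and_boundaryValue_ne_zero hz hg hgM
  have hMm : M - conj m ≠ 0 := fun h => by
    have := congrArg im h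
    rw [sub_im, conj_im, zero_im] at this
    linarith
  set b := Γ₀ (g, z • g)
  obtain ⟨hgG, hg₁⟩ := mem_boundaryExtension.1 hgM
  set a := -(b * (M - conj m))⁻¹ with ha_def
  have ha : a * b * (M - conj m) = -1 := by
    rw [ha_def]; field_simp
  have h_pair : (a • g, z • a • g) = a • (g, z • g) := Prod.ext rfl (smul_comm z a g)
  have h_inv := hG.ringInverse_adjoint_neg_apply_kernel_vector hm hT hφ hz (g := a • g)
    (h_pair ▸ G.smul_mem a hgG) (by
      rw [h_pair, map_smul, map_smul, hg₁, smul_eq_mul, smul_eq_mul]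
      linear_combination ha)
  have h_inner : inner ℂ φ (z • a • g) = a * b * (conj (Γ₀ (φ, 0)) * (M - m) + 1) := by
    have h_green := hG.green _ hφ.mem _ (G.smul_mem a hgG)
    rw [hφ.normalized, map_smul, map_smul, hg₁, ← h_pair, inner_zero_left, map_sub, map_mul,
      conj_conj, map_one, smul_eq_mul, smul_eq_mul] at h_green
    linear_combination h_green
  have h_im := sub_conj m
  rw [livsicCharacteristicFunction_of_imaginaryPart_eq
    (hG.imaginaryPart_neg_eq_smul_rankOne hT hφ), h_inv, h_inner, mul_div_assoc',
    eq_div_iff hMm]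
  push_cast at h_im
  linear_combination (2 * I * m.im) * (conj (Γ₀ (φ, 0)) * (M - m) + 1) * ha +
    (conj (Γ₀ (φ, 0)) * (M - m) + 1) * h_im

theorem exists_inverse_livsic (hG : IsBoundaryTriple G Γ₀ Γ₁) {k : ℝ} (hk : 0 < k)
    (hreg : ∀ u ∈ minimalRelation G Γ₀ Γ₁, k * ‖u.1‖ ≤ ‖u.2‖) (hm : 0 < m.im) :
    ∃ (T : H →L[ℂ] H) (ω : ℂ), IsRelationInverse (boundaryExtension G Γ₀ Γ₁ m) T ∧
      IsBoundedDissipative (-T) ∧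
      Module.finrank ℂ (LinearMap.range ((ℑ (-T) : H →L[ℂ] H) : H →ₗ[ℂ] H)) = 1 ∧
      Filter.Tendsto (livsicCharacteristicFunction (-T)) (Bornology.cobounded ℂ) (nhds 1) ∧
      ω ≠ 0 ∧ ∀ (z M : ℂ) (g : H), 0 < z.im → g ≠ 0 →
        (g, z • g) ∈ boundaryExtension G Γ₀ Γ₁ M →
        livsicCharacteristicFunction (-T) (-1 / z) = ω * ((M - m) / (M - conj m)) := by
  obtain ⟨T, hT⟩ := hG.exists_isRelationInverse hk hreg hm.ne'
  obtain ⟨φ, hφ⟩ := hG.exists_isKernelVector hT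
  have hφ0 := hφ.ne_zero
  have h_imag := hG.imaginaryPart_neg_eq_smul_rankOne hT hφ
  refine ⟨T, _, hT, hG.isBoundedDissipative_neg hT hm.le, ?_,
    tendsto_livsicCharacteristicFunction_cobounded h_imag, fun hω => ?_, fun z M g hz hg hgM =>
    hG.livsicCharacteristicFunction_neg_inverse hm hT hφ hz hg hgM⟩
  · rw [h_imag, ContinuousLinearMap.toLinearMap_smul,
      LinearMap.range_smul _ _ (ofReal_ne_zero.2 hm.ne')]
    exact finrank_range_rankOne hφ0 hφ0
  · have h_conj := congrArg conj hω
    rw [map_sub, map_mul, map_sub, conj_conj, conj_conj, map_one, map_zero] at h_conj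
    have h_mem : (φ, 0) ∈ boundaryExtension G Γ₀ Γ₁ m :=
      mem_boundaryExtension.2 ⟨hφ.mem, by linear_combination hφ.normalized - h_conj⟩
    exact hφ0 (((hT _ _).1 h_mem).symm.trans (map_zero T))

end IsBoundaryTriple

end BoundaryTriples

section CauchyKernels

open scoped ComplexConjugate

/-- The measure `μ` has a finite Poisson integral `∫ dμ(x) / (1 + x²)`: the class of measures that
represent Herglotz functions. -/
class IsPoissonFinite (μ : Measure ℝ) : Prop where
  integrable : Integrable (fun x : ℝ => 1 / (1 + x ^ 2)) μ

/-- The total Poisson mass `∫ dμ(x) / (1 + x²)`. -/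
noncomputable def poissonMass (μ : Measure ℝ) : ℝ :=
  ∫ x : ℝ, 1 / (1 + x ^ 2) ∂μ

open Classical in
/-- The function `1 / (x - z)` as an element of `L²(ℝ; μ)`, with the default value `0` if it is not
square integrable; it is square integrable if `μ` is Poisson finite and `z` is not real. -/
noncomputable def cauchyVector (μ : Measure ℝ) (z : ℂ) : Lp ℂ 2 μ :=
  if h : MemLp (fun x : ℝ => 1 / ((x : ℂ) - z)) 2 μ then h.toLp _ else 0

/-- The Herglotz function with representing measure `μ`, without linear and constant terms. It is
the Weyl function of the boundary triple of the model. -/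
noncomputable def weylFunction (μ : Measure ℝ) (z : ℂ) : ℂ :=
  ∫ x : ℝ, (1 / ((x : ℂ) - z) - (x : ℂ) / (1 + (x : ℂ) ^ 2)) ∂μ

variable {μ : Measure ℝ} {z : ℂ} {f g : Lp ℂ 2 μ}

theorem conj_im_ne_zero (hz : z.im ≠ 0) : (conj z).im ≠ 0 := by
  rwa [conj_im, neg_ne_zero]

theorem I_im_ne_zero : I.im ≠ 0 := by simp

theorem neg_I_im_ne_zero : (-I).im ≠ 0 := by simp

theorem abs_im_le_norm_ofReal_sub (z : ℂ) (x : ℝ) : |z.im| ≤ ‖(x : ℂ) - z‖ := by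
  simpa using abs_im_le_norm ((x : ℂ) - z)

theorem ofReal_sub_ne_zero (hz : z.im ≠ 0) (x : ℝ) : (x : ℂ) - z ≠ 0 :=
  norm_pos_iff.1 ((abs_pos.2 hz).trans_le (abs_im_le_norm_ofReal_sub z x))

theorem one_add_ofReal_sq_eq_mul (x : ℝ) :
    (1 : ℂ) + (x : ℂ) ^ 2 = ((x : ℂ) - -I) * ((x : ℂ) - I) := by
  linear_combination I_sq

theorem norm_ofReal_sub_I_sq (x : ℝ) : ‖(x : ℂ) - I‖ ^ 2 = 1 + x ^ 2 := by
  rw [← normSq_eq_norm_sq, normSq_apply, sub_re, sub_im, ofReal_re, ofReal_im, I_re, I_im]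
  ring

theorem integral_one_div_one_add_ofReal_sq :
    ∫ x : ℝ, 1 / ((1 : ℂ) + (x : ℂ) ^ 2) ∂μ = (poissonMass μ : ℂ) := by
  rw [poissonMass, ← integral_complex_ofReal]
  exact integral_congr_ae (.of_forall fun x => by push_cast; rfl)

theorem poissonMass_pos [hμ : IsPoissonFinite μ] (hμ0 : μ ≠ 0) : 0 < poissonMass μ := by
  have h_pos : ∀ x : ℝ, 0 < 1 / (1 + x ^ 2) := fun x => by positivity
  have h_support : Function.support (fun x : ℝ => 1 / (1 + x ^ 2)) = Set.univ :=
    Set.eq_univ_of_forall fun x => (h_pos x).ne'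
  rw [poissonMass, integral_pos_iff_support_of_nonneg (fun x => (h_pos x).le) hμ.integrable,
    h_support]
  exact Measure.measure_univ_pos.2 hμ0

theorem memLp_div_ofReal_sub {p : ENNReal} {φ : ℝ → ℂ} (hφ : MemLp φ p μ) (hz : z.im ≠ 0) :
    MemLp (fun x => φ x / ((x : ℂ) - z)) p μ := by
  have h_meas : AEMeasurable (fun x : ℝ => (x : ℂ) - z) μ := by fun_prop
  refine hφ.of_le_mul (c := |z.im|⁻¹)
    (hφ.aestronglyMeasurable.aemeasurable.div h_meas).aestronglyMeasurable
    (.of_forall fun x => ?_)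
  rw [norm_div, div_eq_inv_mul]
  gcongr
  exact abs_im_le_norm_ofReal_sub z x

theorem memLp_one_div_ofReal_sub [hμ : IsPoissonFinite μ] (hz : z.im ≠ 0) :
    MemLp (fun x : ℝ => 1 / ((x : ℂ) - z)) 2 μ := by
  have h_I : MemLp (fun x : ℝ => 1 / ((x : ℂ) - I)) 2 μ := by
    rw [memLp_two_iff_integrable_sq_norm (Measurable.aestronglyMeasurable (by fun_prop))]
    refine hμ.integrable.congr (.of_forall fun x => ?_)
    simp only [norm_div, norm_one, div_pow, one_pow, norm_ofReal_sub_I_sq]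
  refine (h_I.add ((memLp_div_ofReal_sub h_I hz).const_mul (z - I))).ae_eq
    (.of_forall fun x => ?_)
  have := ofReal_sub_ne_zero hz x
  have := ofReal_sub_ne_zero I_im_ne_zero x
  simp only [Pi.add_apply]
  field_simp
  ring

theorem coeFn_cauchyVector [IsPoissonFinite μ] (hz : z.im ≠ 0) :
    cauchyVector μ z =ᵐ[μ] fun x : ℝ => 1 / ((x : ℂ) - z) := by
  rw [cauchyVector, dif_pos (memLp_one_div_ofReal_sub hz)]
  exact MemLp.coeFn_toLp _

theorem inner_cauchyVector_integrand [IsPoissonFinite μ] (hz : z.im ≠ 0) :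
    (fun x : ℝ => inner ℂ (cauchyVector μ (conj z) x) (f x)) =ᵐ[μ]
      fun x : ℝ => f x / ((x : ℂ) - z) := by
  filter_upwards [coeFn_cauchyVector (conj_im_ne_zero hz)] with x hx
  rw [hx, RCLike.inner_apply, map_div₀, map_sub, map_one, conj_ofReal, conj_conj, mul_one_div]

theorem integrable_div_ofReal_sub [IsPoissonFinite μ] (hz : z.im ≠ 0) (f : Lp ℂ 2 μ) :
    Integrable (fun x : ℝ => f x / ((x : ℂ) - z)) μ :=
  (L2.integrable_inner _ _).congr (inner_cauchyVector_integrand hz)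

theorem inner_cauchyVector_conj [IsPoissonFinite μ] (hz : z.im ≠ 0) (f : Lp ℂ 2 μ) :
    inner ℂ (cauchyVector μ (conj z)) f = ∫ x : ℝ, f x / ((x : ℂ) - z) ∂μ := by
  rw [L2.inner_def, integral_congr_ae (inner_cauchyVector_integrand hz)]

theorem smul_cauchyVector_ae_eq [IsPoissonFinite μ] (hz : z.im ≠ 0) :
    (z • cauchyVector μ z : Lp ℂ 2 μ) =ᵐ[μ] fun x : ℝ => (x : ℂ) * cauchyVector μ z x - 1 := by
  filter_upwards [Lp.coeFn_smul z (cauchyVector μ z), coeFn_cauchyVector hz] with x h_smul h_coe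
  have := ofReal_sub_ne_zero hz x
  rw [h_smul, Pi.smul_apply, h_coe, smul_eq_mul]
  field_simp
  ring

theorem inner_div_ofReal_sub {f' g' : Lp ℂ 2 μ}
    (hf : f' =ᵐ[μ] fun x : ℝ => f x / ((x : ℂ) - conj z))
    (hg : g' =ᵐ[μ] fun x : ℝ => g x / ((x : ℂ) - z)) :
    (inner ℂ f' g : ℂ) = inner ℂ f g' := by
  rw [L2.inner_def, L2.inner_def]
  refine integral_congr_ae ?_
  filter_upwards [hf, hg] with x hfx hgx
  rw [hfx, hgx, RCLike.inner_apply, RCLike.inner_apply, map_div₀, map_sub, conj_ofReal, conj_conj]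
  ring

end CauchyKernels

section ModelOperators

open scoped ComplexConjugate

variable {μ : Measure ℝ} {z : ℂ} {f g h : Lp ℂ 2 μ}

theorem mem_graph_modelB_iff :
    (f, h) ∈ (modelB μ).graph ↔ h =ᵐ[μ] fun x : ℝ => (x : ℂ) * f x := by
  rw [LinearPMap.mem_graph_iff]
  constructor
  · rintro ⟨y, rfl, rfl⟩
    exact MemLp.coeFn_toLp y.2
  · intro hfh
    have hf : MemLp (fun x : ℝ => (x : ℂ) * f x) 2 μ := (memLp_congr_ae hfh).1 (Lp.memLp h)
    exact ⟨⟨f, hf⟩, rfl, Lp.ext (hf.coeFn_toLp.trans hfh.symm)⟩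

theorem mem_graph_modelBdot_iff :
    (f, h) ∈ (modelBdot μ).graph ↔
      (h =ᵐ[μ] fun x : ℝ => (x : ℂ) * f x) ∧ Integrable f μ ∧ ∫ x, f x ∂μ = 0 := by
  rw [← mem_graph_modelB_iff, LinearPMap.mem_graph_iff, LinearPMap.mem_graph_iff]
  constructor
  · rintro ⟨⟨y, hy⟩, rfl, rfl⟩
    exact ⟨⟨⟨y, hy.2⟩, rfl, rfl⟩, hy.1⟩
  · rintro ⟨⟨y, rfl, rfl⟩, hy⟩
    exact ⟨⟨y, hy, y.2⟩, rfl, rfl⟩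

theorem mem_graph_modelBdot_of_inner_eq_zero [IsPoissonFinite μ] (hz : z.im ≠ 0)
    (hf : inner ℂ (cauchyVector μ (conj z)) f = (0 : ℂ))
    (hg : g =ᵐ[μ] fun x : ℝ => f x / ((x : ℂ) - z)) :
    (g, f + z • g) ∈ (modelBdot μ).graph := by
  refine mem_graph_modelBdot_iff.2 ⟨?_, (integrable_div_ofReal_sub hz f).congr hg.symm, ?_⟩
  · filter_upwards [hg, Lp.coeFn_add f (z • g), Lp.coeFn_smul z g] with x hgx h_add h_smul
    have := ofReal_sub_ne_zero hz x
    rw [h_add, Pi.add_apply, h_smul, Pi.smul_apply, hgx, smul_eq_mul]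
    field_simp
    ring
  · rw [integral_congr_ae hg, ← inner_cauchyVector_conj hz, hf]

-- The vectors orthogonal to the Cauchy kernel at `-i` form the range of `Ḃ - i`, so testing
-- against them identifies `(h + i g) / (x + i) - g` up to a multiple of that kernel.
theorem exists_ae_eq_sub_const_of_mem_adjoint [IsPoissonFinite μ]
    (hgh : (g, h) ∈ (modelBdot μ).graph.adjoint) :
    ∃ c : ℂ, h =ᵐ[μ] fun x : ℝ => (x : ℂ) * g x - c := by
  set k := cauchyVector μ (-I)
  have hr := memLp_div_ofReal_sub (Lp.memLp (h + I • g)) neg_I_im_ne_zero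
  have h_orth : hr.toLp _ - g ∈ (Submodule.span ℂ {k})ᗮᗮ := by
    refine (Submodule.mem_orthogonal _ _).2 fun v hv => ?_
    rw [Submodule.mem_orthogonal_singleton_iff_inner_right] at hv
    have hs := memLp_div_ofReal_sub (Lp.memLp v) I_im_ne_zero
    have h_graph := mem_graph_modelBdot_of_inner_eq_zero I_im_ne_zero (by rwa [conj_I])
      hs.coeFn_toLp
    have h_adj := (Submodule.mem_adjoint_iff _ _).1 hgh _ _ h_graph
    have h_res : (inner ℂ (hs.toLp _) (h + I • g) : ℂ) = inner ℂ v (hr.toLp _) :=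
      inner_div_ofReal_sub (z := -I) (by simpa using hs.coeFn_toLp) hr.coeFn_toLp
    rw [inner_add_left, inner_smul_left, conj_I] at h_adj
    rw [inner_add_right, inner_smul_right] at h_res
    rw [inner_sub_right, ← h_res]
    linear_combination -h_adj
  rw [Submodule.orthogonal_orthogonal, Submodule.mem_span_singleton] at h_orth
  obtain ⟨c, hc⟩ := h_orth
  refine ⟨-c, ?_⟩
  have hc_ae : (c • k : Lp ℂ 2 μ) =ᵐ[μ] (hr.toLp _ - g : Lp ℂ 2 μ) := by rw [hc]
  filter_upwards [hc_ae, Lp.coeFn_smul c k, coeFn_cauchyVector neg_I_im_ne_zero,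
    Lp.coeFn_sub (hr.toLp _) g, hr.coeFn_toLp, Lp.coeFn_add h (I • g), Lp.coeFn_smul I g]
    with x h_eq h_smul h_k h_sub h_r h_add h_Ig
  have hx := ofReal_sub_ne_zero neg_I_im_ne_zero x
  rw [h_smul, h_sub, Pi.smul_apply, Pi.sub_apply, h_k, h_r, h_add, Pi.add_apply, h_Ig,
    Pi.smul_apply, smul_eq_mul, smul_eq_mul, mul_one_div, div_eq_iff hx, sub_mul,
    div_mul_cancel₀ _ hx] at h_eq
  linear_combination -h_eq

theorem mem_adjoint_graph_modelBdot_iff [IsPoissonFinite μ] :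
    (g, h) ∈ (modelBdot μ).graph.adjoint ↔
      ∃ c : ℂ, h =ᵐ[μ] fun x : ℝ => (x : ℂ) * g x - c := by
  refine ⟨exists_ae_eq_sub_const_of_mem_adjoint, ?_⟩
  rintro ⟨c, hc⟩
  refine (Submodule.mem_adjoint_iff _ _).2 fun f f' hf => ?_
  obtain ⟨hf', -, hf0⟩ := mem_graph_modelBdot_iff.1 hf
  have h_zero : ∫ x, c * conj (f x) ∂μ = 0 := by
    rw [integral_const_mul, integral_conj, hf0, map_zero, mul_zero]
  rw [L2.inner_def, L2.inner_def, ← integral_sub (L2.integrable_inner _ _)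
    (L2.integrable_inner _ _), ← h_zero]
  refine integral_congr_ae ?_
  filter_upwards [hc, hf'] with x hcx hfx
  rw [hcx, hfx]
  simp only [RCLike.inner_apply, map_mul, conj_ofReal]
  ring

theorem dense_domain_modelBdot [IsPoissonFinite μ] (hinf : μ Set.univ = ⊤) :
    Dense ((modelBdot μ).domain : Set (Lp ℂ 2 μ)) := by
  rw [Submodule.dense_iff_topologicalClosure_eq_top,
    Submodule.topologicalClosure_eq_top_iff, Submodule.eq_bot_iff]
  intro h hh
  have h_adj : ((0 : Lp ℂ 2 μ), h) ∈ (modelBdot μ).graph.adjoint := by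
    refine (Submodule.mem_adjoint_iff _ _).2 fun f f' hf => ?_
    rw [inner_zero_right, (Submodule.mem_orthogonal _ _).1 hh f
      (LinearPMap.mem_domain_of_mem_graph hf), sub_zero]
  obtain ⟨c, hc⟩ := mem_adjoint_graph_modelBdot_iff.1 h_adj
  have hc' : h =ᵐ[μ] fun _ => -c := by
    filter_upwards [hc, Lp.coeFn_zero ℂ 2 μ] with x hcx h_zero
    rw [hcx, h_zero, Pi.zero_apply, mul_zero, zero_sub]
  have h_const : MemLp (fun _ : ℝ => -c) 2 μ := (memLp_congr_ae hc').1 (Lp.memLp h)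
  rw [memLp_const_iff two_ne_zero ENNReal.ofNat_ne_top, or_iff_left (by simp [hinf])] at h_const
  rw [h_const] at hc'
  exact Lp.ext (hc'.trans (Lp.coeFn_zero ℂ 2 μ).symm)

theorem graph_adjoint_modelBdot [IsPoissonFinite μ] (hinf : μ Set.univ = ⊤) :
    (modelBdot μ).adjoint.graph = (modelBdot μ).graph.adjoint :=
  LinearPMap.adjoint_graph_eq_graph_adjoint (dense_domain_modelBdot hinf)

end ModelOperators

section ModelBoundaryTriple

open scoped ComplexConjugate

variable {μ : Measure ℝ} {z w : ℂ} {g h g₁ h₁ g₂ h₂ : Lp ℂ 2 μ} {c c₁ c₂ : ℂ}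

/-- The functional `(g, h) ↦ ∫ (h - z g) / (x - z) dμ`, which equals `∫ (g - c / (x - z)) dμ` on
the elements `(g, x g - c)` of the adjoint relation. -/
noncomputable def cauchyFunctional (μ : Measure ℝ) (z : ℂ) : Lp ℂ 2 μ × Lp ℂ 2 μ →L[ℂ] ℂ :=
  (innerSL ℂ (cauchyVector μ (conj z))).comp
    (ContinuousLinearMap.snd ℂ _ _ - z • ContinuousLinearMap.fst ℂ _ _)

/-- The boundary value `c` of an element `(g, x g - c)` of the adjoint relation, written as a
bounded functional on the whole space. -/
noncomputable def boundaryZero (μ : Measure ℝ) : Lp ℂ 2 μ × Lp ℂ 2 μ →L[ℂ] ℂ :=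
  (2 * I * (poissonMass μ : ℂ))⁻¹ • (cauchyFunctional μ (-I) - cauchyFunctional μ I)

/-- The boundary value `∫ (g - c x / (1 + x²)) dμ` of an element `(g, x g - c)` of the adjoint
relation, written as a bounded functional on the whole space. -/
noncomputable def boundaryOne (μ : Measure ℝ) : Lp ℂ 2 μ × Lp ℂ 2 μ →L[ℂ] ℂ :=
  (2 : ℂ)⁻¹ • (cauchyFunctional μ (-I) + cauchyFunctional μ I)

/-- The element of the graph of the adjoint given by the deficiency element `1 / (x - z)`. -/
noncomputable def cauchyPair (μ : Measure ℝ) (z : ℂ) : Lp ℂ 2 μ × Lp ℂ 2 μ :=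
  (cauchyVector μ z, z • cauchyVector μ z)

theorem div_ofReal_sub_ae_eq (hz : z.im ≠ 0) (hgh : h =ᵐ[μ] fun x : ℝ => (x : ℂ) * g x - c) :
    (fun x : ℝ => (h - z • g : Lp ℂ 2 μ) x / ((x : ℂ) - z)) =ᵐ[μ]
      fun x : ℝ => g x - c / ((x : ℂ) - z) := by
  filter_upwards [hgh, Lp.coeFn_sub h (z • g), Lp.coeFn_smul z g] with x hx h_sub h_smul
  have := ofReal_sub_ne_zero hz x
  rw [h_sub, Pi.sub_apply, h_smul, Pi.smul_apply, hx, smul_eq_mul]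
  field_simp
  ring

theorem half_add_eq_sub_mul_div (x : ℝ) (a c : ℂ) :
    2⁻¹ * ((a - c / ((x : ℂ) - -I)) + (a - c / ((x : ℂ) - I))) =
      a - c * ((x : ℂ) / (1 + (x : ℂ) ^ 2)) := by
  have := ofReal_sub_ne_zero I_im_ne_zero x
  have := ofReal_sub_ne_zero neg_I_im_ne_zero x
  rw [one_add_ofReal_sq_eq_mul]
  field_simp
  ring

theorem sub_eq_mul_one_div_one_add_sq (x : ℝ) (a c : ℂ) :
    (a - c / ((x : ℂ) - -I)) - (a - c / ((x : ℂ) - I)) =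
      2 * I * c * (1 / (1 + (x : ℂ) ^ 2)) := by
  have := ofReal_sub_ne_zero I_im_ne_zero x
  have := ofReal_sub_ne_zero neg_I_im_ne_zero x
  rw [one_add_ofReal_sq_eq_mul]
  field_simp
  ring

theorem weylFunction_of_sq_eq_neg_one (hz : z ^ 2 = -1) :
    weylFunction μ z = z * poissonMass μ := by
  rw [weylFunction, ← integral_one_div_one_add_ofReal_sq, ← integral_const_mul]
  refine integral_congr_ae (.of_forall fun x => ?_)
  have h_factor : (1 : ℂ) + (x : ℂ) ^ 2 = ((x : ℂ) - z) * ((x : ℂ) + z) := by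
    linear_combination hz
  have h_ne : (1 : ℂ) + (x : ℂ) ^ 2 ≠ 0 := by
    exact_mod_cast (by positivity : (0 : ℝ) < 1 + x ^ 2).ne'
  rw [h_factor, mul_ne_zero_iff] at h_ne
  obtain ⟨h_sub, h_add⟩ := h_ne
  simp only [h_factor]
  field_simp
  ring

variable [IsPoissonFinite μ]

theorem integrable_sub_div_ofReal_sub (hz : z.im ≠ 0)
    (hgh : h =ᵐ[μ] fun x : ℝ => (x : ℂ) * g x - c) :
    Integrable (fun x : ℝ => g x - c / ((x : ℂ) - z)) μ :=
  (integrable_div_ofReal_sub hz _).congr (div_ofReal_sub_ae_eq hz hgh)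

theorem cauchyFunctional_eq_integral (hz : z.im ≠ 0)
    (hgh : h =ᵐ[μ] fun x : ℝ => (x : ℂ) * g x - c) :
    cauchyFunctional μ z (g, h) = ∫ x : ℝ, (g x - c / ((x : ℂ) - z)) ∂μ :=
  (inner_cauchyVector_conj hz _).trans (integral_congr_ae (div_ofReal_sub_ae_eq hz hgh))

theorem integrable_sub_mul_div_one_add_sq (hgh : h =ᵐ[μ] fun x : ℝ => (x : ℂ) * g x - c) :
    Integrable (fun x : ℝ => g x - c * ((x : ℂ) / (1 + (x : ℂ) ^ 2))) μ :=
  (((integrable_sub_div_ofReal_sub neg_I_im_ne_zero hgh).add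
    (integrable_sub_div_ofReal_sub I_im_ne_zero hgh)).const_mul 2⁻¹).congr
    (.of_forall fun x => half_add_eq_sub_mul_div x (g x) c)

theorem boundaryOne_eq_integral (hgh : h =ᵐ[μ] fun x : ℝ => (x : ℂ) * g x - c) :
    boundaryOne μ (g, h) = ∫ x : ℝ, (g x - c * ((x : ℂ) / (1 + (x : ℂ) ^ 2))) ∂μ := by
  rw [boundaryOne, smul_apply, add_apply, cauchyFunctional_eq_integral neg_I_im_ne_zero hgh,
    cauchyFunctional_eq_integral I_im_ne_zero hgh,
    ← integral_add (integrable_sub_div_ofReal_sub neg_I_im_ne_zero hgh)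
      (integrable_sub_div_ofReal_sub I_im_ne_zero hgh), smul_eq_mul, ← integral_const_mul]
  exact integral_congr_ae (.of_forall fun x => half_add_eq_sub_mul_div x (g x) c)

theorem boundaryZero_eq (hμ : μ ≠ 0) (hgh : h =ᵐ[μ] fun x : ℝ => (x : ℂ) * g x - c) :
    boundaryZero μ (g, h) = c := by
  have h_mass : (poissonMass μ : ℂ) ≠ 0 := ofReal_ne_zero.2 (poissonMass_pos hμ).ne'
  rw [boundaryZero, smul_apply, sub_apply, cauchyFunctional_eq_integral neg_I_im_ne_zero hgh,
    cauchyFunctional_eq_integral I_im_ne_zero hgh,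
    ← integral_sub (integrable_sub_div_ofReal_sub neg_I_im_ne_zero hgh)
      (integrable_sub_div_ofReal_sub I_im_ne_zero hgh)]
  simp only [sub_eq_mul_one_div_one_add_sq]
  rw [integral_const_mul, integral_one_div_one_add_ofReal_sq, smul_eq_mul]
  field_simp

theorem inner_sub_inner_eq_boundary (hμ : μ ≠ 0)
    (h₁_eq : h₁ =ᵐ[μ] fun x : ℝ => (x : ℂ) * g₁ x - c₁)
    (h₂_eq : h₂ =ᵐ[μ] fun x : ℝ => (x : ℂ) * g₂ x - c₂) :
    inner ℂ g₁ h₂ - inner ℂ h₁ g₂ =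
      conj (boundaryZero μ (g₁, h₁)) * boundaryOne μ (g₂, h₂) -
        conj (boundaryOne μ (g₁, h₁)) * boundaryZero μ (g₂, h₂) := by
  have h_int₁ : Integrable (fun x : ℝ => conj (g₁ x - c₁ * ((x : ℂ) / (1 + (x : ℂ) ^ 2)))) μ :=
    (LinearIsometryEquiv.integrable_comp_iff conjLIE).2 (integrable_sub_mul_div_one_add_sq h₁_eq)
  rw [boundaryZero_eq hμ h₁_eq, boundaryZero_eq hμ h₂_eq, boundaryOne_eq_integral h₁_eq,
    boundaryOne_eq_integral h₂_eq, ← integral_conj, ← integral_const_mul, ← integral_mul_const,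
    L2.inner_def, L2.inner_def, ← integral_sub (L2.integrable_inner _ _)
      (L2.integrable_inner _ _), ← integral_sub
      ((integrable_sub_mul_div_one_add_sq h₂_eq).const_mul _) (h_int₁.mul_const _)]
  refine integral_congr_ae ?_
  filter_upwards [h₁_eq, h₂_eq] with x hx₁ hx₂
  rw [hx₁, hx₂]
  simp only [RCLike.inner_apply, map_mul, map_sub, map_div₀, map_add, map_one, map_pow,
    conj_ofReal]
  ring

theorem minimalRelation_model (hμ : μ ≠ 0) :
    minimalRelation (modelBdot μ).graph.adjoint (boundaryZero μ) (boundaryOne μ) =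
      (modelBdot μ).graph := by
  ext ⟨g, h⟩
  rw [mem_minimalRelation, mem_adjoint_graph_modelBdot_iff, mem_graph_modelBdot_iff]
  constructor
  · rintro ⟨⟨c, hc⟩, h_zero, h_one⟩
    obtain rfl : c = 0 := (boundaryZero_eq hμ hc).symm.trans h_zero
    have h_int := integrable_sub_mul_div_one_add_sq hc
    rw [boundaryOne_eq_integral hc] at h_one
    simp only [zero_mul, sub_zero] at hc h_int h_one
    exact ⟨hc, h_int, h_one⟩
  · rintro ⟨hgh, -, hg⟩
    have hc : h =ᵐ[μ] fun x : ℝ => (x : ℂ) * g x - 0 := by simpa only [sub_zero] using hgh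
    refine ⟨⟨0, hc⟩, boundaryZero_eq hμ hc, ?_⟩
    simpa only [boundaryOne_eq_integral hc, zero_mul, sub_zero] using hg

theorem cauchyPair_mem_adjoint (hz : z.im ≠ 0) :
    cauchyPair μ z ∈ (modelBdot μ).graph.adjoint :=
  mem_adjoint_graph_modelBdot_iff.2 ⟨1, smul_cauchyVector_ae_eq hz⟩

theorem boundaryZero_cauchyPair (hμ : μ ≠ 0) (hz : z.im ≠ 0) :
    boundaryZero μ (cauchyPair μ z) = 1 :=
  boundaryZero_eq hμ (smul_cauchyVector_ae_eq hz)

theorem cauchyVector_ne_zero (hμ : μ ≠ 0) (hz : z.im ≠ 0) : cauchyVector μ z ≠ 0 := by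
  intro hk
  have h_one := boundaryZero_cauchyPair hμ hz
  rw [cauchyPair, hk, smul_zero, Prod.mk_zero_zero, map_zero] at h_one
  exact zero_ne_one h_one

theorem weylFunction_integrand_ae_eq (hz : z.im ≠ 0) :
    (fun x : ℝ => cauchyVector μ z x - 1 * ((x : ℂ) / (1 + (x : ℂ) ^ 2))) =ᵐ[μ]
      fun x : ℝ => 1 / ((x : ℂ) - z) - (x : ℂ) / (1 + (x : ℂ) ^ 2) := by
  filter_upwards [coeFn_cauchyVector hz] with x hx
  rw [hx, one_mul]

theorem boundaryOne_cauchyPair (hz : z.im ≠ 0) :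
    boundaryOne μ (cauchyPair μ z) = weylFunction μ z :=
  (boundaryOne_eq_integral (smul_cauchyVector_ae_eq hz)).trans
    (integral_congr_ae (weylFunction_integrand_ae_eq hz))

theorem integrable_weylFunction (hz : z.im ≠ 0) :
    Integrable (fun x : ℝ => 1 / ((x : ℂ) - z) - (x : ℂ) / (1 + (x : ℂ) ^ 2)) μ :=
  (integrable_sub_mul_div_one_add_sq (smul_cauchyVector_ae_eq hz)).congr
    (weylFunction_integrand_ae_eq hz)

theorem sub_mul_inner_cauchyVector (hz : z.im ≠ 0) (hw : w.im ≠ 0) :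
    (z - w) * inner ℂ (cauchyVector μ (conj w)) (cauchyVector μ z) =
      weylFunction μ z - weylFunction μ w := by
  rw [inner_cauchyVector_conj hw, ← integral_const_mul, weylFunction, weylFunction,
    ← integral_sub (integrable_weylFunction hz) (integrable_weylFunction hw)]
  refine integral_congr_ae ?_
  filter_upwards [coeFn_cauchyVector hz] with x hx
  have := ofReal_sub_ne_zero hz x
  have := ofReal_sub_ne_zero hw x
  rw [hx, sub_sub_sub_cancel_right]
  field_simp
  ring

end ModelBoundaryTriple

section ModelTriple

open scoped ComplexConjugate

/-- The parameter `m` of the boundary condition `Γ₁ = m Γ₀` that corresponds to the von Neumann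
parameter `κ` if the Poisson mass is `1`. -/
noncomputable def boundaryParameter (κ : ℂ) : ℂ :=
  I * (1 + κ) / (1 - κ)

theorem one_sub_ne_zero_of_norm_lt_one {κ : ℂ} (hκ : ‖κ‖ < 1) : 1 - κ ≠ 0 := by
  rw [sub_ne_zero]
  rintro rfl
  exact hκ.ne norm_one

theorem conj_boundaryParameter (κ : ℂ) :
    conj (boundaryParameter κ) = -I * (1 + conj κ) / (1 - conj κ) := by
  simp [boundaryParameter]

theorem boundaryParameter_im_pos {κ : ℂ} (hκ : ‖κ‖ < 1) : 0 < (boundaryParameter κ).im := by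
  have h_im : (boundaryParameter κ).im = (1 - ‖κ‖ ^ 2) / normSq (1 - κ) := by
    rw [boundaryParameter, div_im, ← normSq_eq_norm_sq, normSq_apply κ]
    simp only [mul_re, mul_im, add_re, add_im, sub_re, sub_im, one_re, one_im, I_re, I_im]
    ring
  rw [h_im]
  have h_normSq := normSq_pos.2 (one_sub_ne_zero_of_norm_lt_one hκ)
  have h_num : ‖κ‖ ^ 2 < 1 := pow_lt_one₀ (norm_nonneg κ) hκ two_ne_zero
  exact div_pos (sub_pos.2 h_num) h_normSq

theorem add_I_ne_zero_of_im_pos {M : ℂ} (hM : 0 < M.im) : M + I ≠ 0 := fun h => by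
  have := congrArg im h
  rw [add_im, I_im, zero_im] at this
  linarith

theorem moebius_cayley_eq {κ M : ℂ} (hκ : ‖κ‖ < 1) (hM : 0 < M.im) :
    ((M - I) / (M + I) - κ) / (conj κ * ((M - I) / (M + I)) - 1) =
      -((1 - κ) / (1 - conj κ)) *
        ((M - boundaryParameter κ) / (M - conj (boundaryParameter κ))) := by
  have hκ₁ := one_sub_ne_zero_of_norm_lt_one hκ
  have hκ₂ := one_sub_ne_zero_of_norm_lt_one ((norm_conj κ).trans_lt hκ)
  have hM₁ := add_I_ne_zero_of_im_pos hM
  have h_num : (M - I) / (M + I) - κ = (1 - κ) * (M - boundaryParameter κ) / (M + I) := by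
    rw [boundaryParameter]
    field_simp
    ring
  have h_den : conj κ * ((M - I) / (M + I)) - 1 =
      -((1 - conj κ) * (M - conj (boundaryParameter κ))) / (M + I) := by
    rw [conj_boundaryParameter]
    field_simp
    ring
  rw [h_num, h_den, div_div_div_cancel_right₀ hM₁, div_neg, neg_mul, div_mul_div_comm]

theorem tendsto_neg_one_div_cobounded :
    Filter.Tendsto (fun z : ℂ => -1 / z) (nhdsWithin 0 {z : ℂ | 0 < z.im})
      (Bornology.cobounded ℂ) := by
  have h_le : nhdsWithin (0 : ℂ) {z : ℂ | 0 < z.im} ≤ nhdsWithin 0 {0}ᶜ :=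
    nhdsWithin_mono _ fun z (hz : 0 < z.im) (h : z = 0) => by simp [h] at hz
  have h_inv : Filter.Tendsto (fun z : ℂ => -z⁻¹) (nhdsWithin 0 {z : ℂ | 0 < z.im})
      (Bornology.cobounded ℂ) :=
    Filter.tendsto_neg_cobounded.comp (Filter.tendsto_inv₀_nhdsNE_zero.mono_left h_le)
  exact h_inv.congr fun z => by rw [neg_div, one_div]

theorem exists_mul_norm_le_of_isQuasiRegularPoint_zero {H : Type*} [NormedAddCommGroup H]
    [InnerProductSpace ℂ H] {A : H →ₗ.[ℂ] H} (hA : IsQuasiRegularPoint A 0) :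
    ∃ k : ℝ, 0 < k ∧ ∀ u ∈ A.graph, k * ‖u.1‖ ≤ ‖u.2‖ := by
  obtain ⟨k, hk, hbound⟩ := hA
  refine ⟨k, hk, fun u hu => ?_⟩
  obtain ⟨f, hf, hAf⟩ := (LinearPMap.mem_graph_iff A).1 hu
  simpa only [zero_smul, sub_zero, hf, hAf] using hbound f

variable {μ : Measure ℝ} {z : ℂ}

theorem isBoundaryTriple_model [IsPoissonFinite μ] (hμ : μ ≠ 0) :
    IsBoundaryTriple (modelBdot μ).graph.adjoint (boundaryZero μ) (boundaryOne μ) where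
  green := by
    rintro ⟨g₁, h₁⟩ hu ⟨g₂, h₂⟩ hv
    obtain ⟨c₁, hc₁⟩ := mem_adjoint_graph_modelBdot_iff.1 hu
    obtain ⟨c₂, hc₂⟩ := mem_adjoint_graph_modelBdot_iff.1 hv
    exact inner_sub_inner_eq_boundary hμ hc₁ hc₂
  surjective := by
    intro a b
    have h_mass : (poissonMass μ : ℂ) ≠ 0 := ofReal_ne_zero.2 (poissonMass_pos hμ).ne'
    set d := b / (I * poissonMass μ)
    have hb : b = d * (I * poissonMass μ) := (div_mul_cancel₀ _ (mul_ne_zero I_ne_zero h_mass)).symm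
    refine ⟨((a + d) / 2) • cauchyPair μ I + ((a - d) / 2) • cauchyPair μ (-I),
      Submodule.add_mem _ (Submodule.smul_mem _ _ (cauchyPair_mem_adjoint I_im_ne_zero))
        (Submodule.smul_mem _ _ (cauchyPair_mem_adjoint neg_I_im_ne_zero)), ?_, ?_⟩
    · rw [map_add, map_smul, map_smul, boundaryZero_cauchyPair hμ I_im_ne_zero,
        boundaryZero_cauchyPair hμ neg_I_im_ne_zero, smul_eq_mul, smul_eq_mul]
      ring
    · rw [map_add, map_smul, map_smul, boundaryOne_cauchyPair I_im_ne_zero,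
        boundaryOne_cauchyPair neg_I_im_ne_zero, weylFunction_of_sq_eq_neg_one I_sq,
        weylFunction_of_sq_eq_neg_one (by rw [neg_sq, I_sq]), smul_eq_mul, smul_eq_mul, hb]
      ring
  adjoint_le := by rw [minimalRelation_model hμ]

theorem cauchyPair_mem_boundaryExtension [IsPoissonFinite μ] (hμ : μ ≠ 0) (hz : z.im ≠ 0) :
    cauchyPair μ z ∈ boundaryExtension (modelBdot μ).graph.adjoint (boundaryZero μ)
      (boundaryOne μ) (weylFunction μ z) :=
  mem_boundaryExtension.2 ⟨cauchyPair_mem_adjoint hz, by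
    rw [boundaryOne_cauchyPair hz, boundaryZero_cauchyPair hμ hz, mul_one]⟩

theorem weylFunction_im_pos [IsPoissonFinite μ] (hμ : μ ≠ 0) (hz : 0 < z.im) :
    0 < (weylFunction μ z).im :=
  ((isBoundaryTriple_model hμ).im_pos_and_boundaryValue_ne_zero hz
    (cauchyVector_ne_zero hμ hz.ne') (cauchyPair_mem_boundaryExtension hμ hz.ne')).1

theorem norm_cauchyVector_sq_of_sq_eq_neg_one [IsPoissonFinite μ] (hz : z ^ 2 = -1) :
    ‖cauchyVector μ z‖ ^ 2 = poissonMass μ := by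
  have h_cases : z = I ∨ z = -I := sq_eq_sq_iff_eq_or_eq_neg.1 (hz.trans I_sq.symm)
  have h_im : z.im ≠ 0 := by rcases h_cases with rfl | rfl <;> simp
  have h_conj : conj z = -z := by rcases h_cases with rfl | rfl <;> simp
  have hz₀ : z ≠ 0 := by rintro rfl; exact h_im zero_im
  have h_inner := sub_mul_inner_cauchyVector (μ := μ) h_im (conj_im_ne_zero h_im)
  rw [conj_conj, inner_self_eq_norm_sq_to_K, h_conj, weylFunction_of_sq_eq_neg_one hz,
    weylFunction_of_sq_eq_neg_one (by rwa [neg_sq])] at h_inner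
  have h_cancel : (2 * z) * (‖cauchyVector μ z‖ : ℂ) ^ 2 = (2 * z) * poissonMass μ := by
    linear_combination h_inner
  exact_mod_cast mul_left_cancel₀ (mul_ne_zero two_ne_zero hz₀) h_cancel

theorem add_I_mul_inner_cauchyVector_I [IsPoissonFinite μ] (hz : z.im ≠ 0) :
    (z + I) * inner ℂ (cauchyVector μ I) (cauchyVector μ z) =
      weylFunction μ z + poissonMass μ * I := by
  have h_inner := sub_mul_inner_cauchyVector (μ := μ) hz neg_I_im_ne_zero
  rw [map_neg, conj_I, neg_neg,
    weylFunction_of_sq_eq_neg_one (z := -I) (by rw [neg_sq, I_sq])] at h_inner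
  linear_combination h_inner

theorem sub_I_mul_inner_cauchyVector_neg_I [IsPoissonFinite μ] (hz : z.im ≠ 0) :
    (z - I) * inner ℂ (cauchyVector μ (-I)) (cauchyVector μ z) =
      weylFunction μ z - poissonMass μ * I := by
  have h_inner := sub_mul_inner_cauchyVector (μ := μ) hz I_im_ne_zero
  rw [conj_I, weylFunction_of_sq_eq_neg_one (z := I) I_sq] at h_inner
  linear_combination h_inner

theorem cauchyVector_sub_mem_domain_modelB [IsPoissonFinite μ] {z w : ℂ} (hz : z.im ≠ 0)
    (hw : w.im ≠ 0) : cauchyVector μ z - cauchyVector μ w ∈ (modelB μ).domain := by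
  refine LinearPMap.mem_domain_of_mem_graph (mem_graph_modelB_iff.2 ?_ :
    (_, z • cauchyVector μ z - w • cauchyVector μ w) ∈ (modelB μ).graph)
  filter_upwards [Lp.coeFn_sub (cauchyVector μ z) (cauchyVector μ w),
    Lp.coeFn_sub (z • cauchyVector μ z) (w • cauchyVector μ w), smul_cauchyVector_ae_eq hz,
    smul_cauchyVector_ae_eq hw] with x h_sub h_smul_sub hzx hwx
  rw [h_sub, h_smul_sub, Pi.sub_apply, Pi.sub_apply, hzx, hwx]
  ring

theorem setOf_ae_eq_sub_mul_eq_singleton [IsPoissonFinite μ] (κ : ℂ) :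
    {f : Lp ℂ 2 μ | f =ᵐ[μ] fun x : ℝ => 1 / ((x : ℂ) - I) - κ * (1 / ((x : ℂ) + I))} =
      {cauchyVector μ I - κ • cauchyVector μ (-I)} := by
  have h_ae : (cauchyVector μ I - κ • cauchyVector μ (-I) : Lp ℂ 2 μ) =ᵐ[μ]
      fun x : ℝ => 1 / ((x : ℂ) - I) - κ * (1 / ((x : ℂ) + I)) := by
    filter_upwards [Lp.coeFn_sub (cauchyVector μ I) (κ • cauchyVector μ (-I)),
      Lp.coeFn_smul κ (cauchyVector μ (-I)), coeFn_cauchyVector I_im_ne_zero,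
      coeFn_cauchyVector neg_I_im_ne_zero] with x h_sub h_smul h_I h_neg
    rw [h_sub, Pi.sub_apply, h_smul, Pi.smul_apply, h_I, h_neg, smul_eq_mul, sub_neg_eq_add]
  ext f
  exact ⟨fun hf => Lp.ext (Filter.EventuallyEq.trans hf h_ae.symm), fun hf => hf ▸ h_ae⟩

theorem cauchyPair_sub_mem_boundaryExtension [IsPoissonFinite μ] (hμ : μ ≠ 0) {κ : ℂ}
    (hκ : κ ≠ 1) : cauchyPair μ I - κ • cauchyPair μ (-I) ∈
      boundaryExtension (modelBdot μ).graph.adjoint (boundaryZero μ) (boundaryOne μ)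
        (poissonMass μ * boundaryParameter κ) := by
  have hκ' := sub_ne_zero.2 hκ.symm
  refine mem_boundaryExtension.2 ⟨Submodule.sub_mem _ (cauchyPair_mem_adjoint I_im_ne_zero)
    (Submodule.smul_mem _ _ (cauchyPair_mem_adjoint neg_I_im_ne_zero)), ?_⟩
  rw [map_sub, map_sub, map_smul, map_smul, boundaryZero_cauchyPair hμ I_im_ne_zero,
    boundaryZero_cauchyPair hμ neg_I_im_ne_zero, boundaryOne_cauchyPair I_im_ne_zero,
    boundaryOne_cauchyPair neg_I_im_ne_zero, weylFunction_of_sq_eq_neg_one I_sq,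
    weylFunction_of_sq_eq_neg_one (by rw [neg_sq, I_sq]), smul_eq_mul, smul_eq_mul, mul_one,
    boundaryParameter]
  field_simp
  ring

theorem graph_modelBhat [IsPoissonFinite μ] (hinf : μ Set.univ = ⊤) {κ : ℂ} (hκ : κ ≠ 1) :
    (modelBhat μ κ).graph =
      boundaryExtension (modelBdot μ).graph.adjoint (boundaryZero μ) (boundaryOne μ)
        (poissonMass μ * boundaryParameter κ) := by
  have hμ : μ ≠ 0 := by rintro rfl; simp at hinf
  have he := cauchyPair_sub_mem_boundaryExtension hμ hκ
  have he₀ : boundaryZero μ (cauchyPair μ I - κ • cauchyPair μ (-I)) ≠ 0 := by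
    rw [map_sub, map_smul, boundaryZero_cauchyPair hμ I_im_ne_zero,
      boundaryZero_cauchyPair hμ neg_I_im_ne_zero, smul_eq_mul, mul_one]
    exact sub_ne_zero.2 hκ.symm
  have h_domain : (modelBdot μ).domain ⊔ Submodule.span ℂ {f : Lp ℂ 2 μ |
      f =ᵐ[μ] fun x : ℝ => 1 / ((x : ℂ) - I) - κ * (1 / ((x : ℂ) + I))} =
      (boundaryExtension (modelBdot μ).graph.adjoint (boundaryZero μ) (boundaryOne μ)
        (poissonMass μ * boundaryParameter κ)).map (LinearMap.fst ℂ _ _) := by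
    rw [boundaryExtension_eq_sup_span he he₀, minimalRelation_model hμ, Submodule.map_sup,
      LinearPMap.graph_map_fst_eq_domain, Submodule.map_span, Set.image_singleton,
      setOf_ae_eq_sub_mul_eq_singleton]
    rfl
  rw [modelBhat, h_domain]
  exact graph_domRestrict_map_fst (graph_adjoint_modelBdot hinf ▸ inf_le_left)

namespace IsModelData

variable {S s : ℂ → ℂ} {κ : ℂ}

theorem isPoissonFinite (hmodel : IsModelData S s κ μ) : IsPoissonFinite μ where
  integrable := by
    refine ⟨Measurable.aestronglyMeasurable (by fun_prop), ?_⟩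
    rw [hasFiniteIntegral_iff_ofReal (.of_forall fun x => by positivity), hmodel.normalized]
    exact ENNReal.one_lt_top

theorem poissonMass_eq_one (hmodel : IsModelData S s κ μ) : poissonMass μ = 1 := by
  rw [poissonMass, integral_eq_lintegral_of_nonneg_ae (.of_forall fun x => by positivity)
    (Measurable.aestronglyMeasurable (by fun_prop)), hmodel.normalized, ENNReal.toReal_one]

theorem measure_ne_zero (hmodel : IsModelData S s κ μ) : μ ≠ 0 := by
  rintro rfl
  simpa using hmodel.measure_univ

theorem weylFunction_im_pos (hmodel : IsModelData S s κ μ) (hz : 0 < z.im) :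
    0 < (weylFunction μ z).im :=
  have := hmodel.isPoissonFinite
  _root_.weylFunction_im_pos hmodel.measure_ne_zero hz

theorem livsicFunction_eq (hmodel : IsModelData S s κ μ) (hz : 0 < z.im) :
    s z = (weylFunction μ z - I) / (weylFunction μ z + I) := by
  have h_rep : 1 / I * ((s z + 1) / (s z - 1)) = weylFunction μ z := hmodel.representation z hz
  have h_im := hmodel.weylFunction_im_pos hz
  have hs : s z - 1 ≠ 0 := fun h => by simp [← h_rep, h] at h_im
  have h_cayley : weylFunction μ z * (s z - 1) = -I * (s z + 1) := by
    rw [← h_rep, one_div, inv_I, mul_assoc, div_mul_cancel₀ _ hs]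
  rw [eq_div_iff (add_I_ne_zero_of_im_pos h_im)]
  linear_combination h_cayley

theorem exists_eq_mul_moebius_weylFunction (hmodel : IsModelData S s κ μ) :
    ∃ a : ℂ, a ≠ 0 ∧ ∀ z : ℂ, 0 < z.im → S z = a * ((weylFunction μ z - boundaryParameter κ) /
      (weylFunction μ z - conj (boundaryParameter κ))) := by
  have hκ := hmodel.norm_kappa_lt
  refine ⟨-((1 - κ) / (1 - conj κ)), neg_ne_zero.2 (div_ne_zero
    (one_sub_ne_zero_of_norm_lt_one hκ)
    (one_sub_ne_zero_of_norm_lt_one ((norm_conj κ).trans_lt hκ))), fun z hz => ?_⟩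
  rw [hmodel.S_eq z hz, hmodel.livsicFunction_eq hz,
    moebius_cayley_eq hκ (hmodel.weylFunction_im_pos hz)]

theorem graph_modelBhat (hmodel : IsModelData S s κ μ) :
    (modelBhat μ κ).graph = boundaryExtension (modelBdot μ).graph.adjoint (boundaryZero μ)
      (boundaryOne μ) (boundaryParameter κ) := by
  have := hmodel.isPoissonFinite
  have hκ : κ ≠ 1 := fun h => hmodel.norm_kappa_lt.ne (h ▸ norm_one)
  rw [_root_.graph_modelBhat hmodel.measure_univ hκ, hmodel.poissonMass_eq_one, ofReal_one,
    one_mul]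

theorem norm_cauchyVector_eq_one (hmodel : IsModelData S s κ μ) (hz : z ^ 2 = -1) :
    ‖cauchyVector μ z‖ = 1 := by
  have := hmodel.isPoissonFinite
  rw [← sq_eq_sq₀ (norm_nonneg _) zero_le_one, norm_cauchyVector_sq_of_sq_eq_neg_one hz,
    hmodel.poissonMass_eq_one, one_pow]

theorem isDeficiencyElement_cauchyVector (hmodel : IsModelData S s κ μ) (hz : z.im ≠ 0) :
    IsDeficiencyElement (modelBdot μ) z (cauchyVector μ z) := by
  have := hmodel.isPoissonFinite
  rw [IsDeficiencyElement, graph_adjoint_modelBdot hmodel.measure_univ]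
  exact cauchyPair_mem_adjoint hz

theorem cauchyVector_sub_mem_domain_modelBhat (hmodel : IsModelData S s κ μ) :
    cauchyVector μ I - κ • cauchyVector μ (-I) ∈ (modelBhat μ κ).domain := by
  have := hmodel.isPoissonFinite
  have hκ : κ ≠ 1 := fun h => hmodel.norm_kappa_lt.ne (h ▸ norm_one)
  refine LinearPMap.mem_domain_of_mem_graph
    (y := (cauchyPair μ I - κ • cauchyPair μ (-I)).2) ?_
  rw [_root_.graph_modelBhat hmodel.measure_univ hκ]
  exact cauchyPair_sub_mem_boundaryExtension hmodel.measure_ne_zero hκ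

theorem add_I_mul_inner_cauchyVector_I (hmodel : IsModelData S s κ μ) (hz : z.im ≠ 0) :
    (z + I) * inner ℂ (cauchyVector μ I) (cauchyVector μ z) = weylFunction μ z + I := by
  have := hmodel.isPoissonFinite
  rw [_root_.add_I_mul_inner_cauchyVector_I hz, hmodel.poissonMass_eq_one, ofReal_one, one_mul]

theorem inner_cauchyVector_I_ne_zero (hmodel : IsModelData S s κ μ) (hz : 0 < z.im) :
    inner ℂ (cauchyVector μ I) (cauchyVector μ z) ≠ (0 : ℂ) := by
  refine right_ne_zero_of_mul (a := z + I) ?_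
  rw [hmodel.add_I_mul_inner_cauchyVector_I hz.ne']
  exact add_I_ne_zero_of_im_pos (hmodel.weylFunction_im_pos hz)

theorem livsicFunction_eq_inner (hmodel : IsModelData S s κ μ) (hz : 0 < z.im) :
    s z = (z - I) / (z + I) * (inner ℂ (cauchyVector μ (-I)) (cauchyVector μ z) /
      inner ℂ (cauchyVector μ I) (cauchyVector μ z)) := by
  have := hmodel.isPoissonFinite
  rw [div_mul_div_comm, hmodel.add_I_mul_inner_cauchyVector_I hz.ne',
    sub_I_mul_inner_cauchyVector_neg_I hz.ne', hmodel.poissonMass_eq_one, ofReal_one, one_mul,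
    hmodel.livsicFunction_eq hz]

theorem isTripleCharacteristicFunction (hmodel : IsModelData S s κ μ) :
    IsTripleCharacteristicFunction (modelBdot μ) (modelBhat μ κ) (modelB μ) S := by
  have := hmodel.isPoissonFinite
  exact ⟨cauchyVector μ I, cauchyVector μ (-I), κ,
    hmodel.isDeficiencyElement_cauchyVector I_im_ne_zero,
    hmodel.isDeficiencyElement_cauchyVector neg_I_im_ne_zero,
    hmodel.norm_cauchyVector_eq_one I_sq,
    hmodel.norm_cauchyVector_eq_one (by rw [neg_sq, I_sq]),
    cauchyVector_sub_mem_domain_modelB I_im_ne_zero neg_I_im_ne_zero, hmodel.norm_kappa_lt,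
    hmodel.cauchyVector_sub_mem_domain_modelBhat, fun z hz => ⟨cauchyVector μ z,
      cauchyVector_ne_zero hmodel.measure_ne_zero hz.ne',
      hmodel.isDeficiencyElement_cauchyVector hz.ne', hmodel.inner_cauchyVector_I_ne_zero hz,
      s z, hmodel.livsicFunction_eq_inner hz, hmodel.S_eq z hz⟩⟩

end IsModelData

end ModelTriple

theorem mainTheorem3 (S s : ℂ → ℂ) (κ : ℂ) (μ : Measure ℝ) (hmodel : IsModelData S s κ μ)
    (h0 : IsQuasiRegularPoint (modelBdot μ) 0) :
    IsTripleCharacteristicFunction (modelBdot μ) (modelBhat μ κ) (modelB μ) S ∧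
    ∃ (T : Lp ℂ 2 μ →L[ℂ] Lp ℂ 2 μ) (S₀ : ℂ),
      IsBoundedInverse (modelBhat μ κ) T ∧
      IsBoundedDissipative (-T) ∧
      Module.finrank ℂ (LinearMap.range ((ℑ (-T) : Lp ℂ 2 μ →L[ℂ] Lp ℂ 2 μ) :
        Lp ℂ 2 μ →ₗ[ℂ] Lp ℂ 2 μ)) = 1 ∧
      Filter.Tendsto S (nhdsWithin 0 {z : ℂ | 0 < z.im}) (nhds S₀) ∧ S₀ ≠ 0 ∧
      ∀ z : ℂ, 0 < z.im → livsicCharacteristicFunction (-T) (-1 / z) = S z / S₀ := by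
  have := hmodel.isPoissonFinite
  have hμ := hmodel.measure_ne_zero
  obtain ⟨k, hk, hreg⟩ := exists_mul_norm_le_of_isQuasiRegularPoint_zero h0
  rw [← minimalRelation_model hμ] at hreg
  obtain ⟨T, ω, hT, h_diss, h_rank, h_lim, hω, h_livsic⟩ :=
    (isBoundaryTriple_model hμ).exists_inverse_livsic hk hreg
      (boundaryParameter_im_pos hmodel.norm_kappa_lt)
  obtain ⟨a, ha, hS⟩ := hmodel.exists_eq_mul_moebius_weylFunction
  have h_quot (z : ℂ) (hz : 0 < z.im) :
      livsicCharacteristicFunction (-T) (-1 / z) = S z / (a / ω) := by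
    rw [h_livsic z _ _ hz (cauchyVector_ne_zero hμ hz.ne')
      (cauchyPair_mem_boundaryExtension hμ hz.ne'), hS z hz]
    field_simp
  have hS₀ : a / ω ≠ 0 := div_ne_zero ha hω
  have h_tendsto := (h_lim.comp tendsto_neg_one_div_cobounded).const_mul (a / ω)
  rw [mul_one] at h_tendsto
  refine ⟨hmodel.isTripleCharacteristicFunction, T, a / ω, ?_, h_diss, h_rank,
    h_tendsto.congr' (eventually_mem_nhdsWithin.mono fun z hz => ?_), hS₀, h_quot⟩
  · rwa [IsBoundedInverse, hmodel.graph_modelBhat]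
  · rw [Function.comp_apply, h_quot z hz, mul_div_cancel₀ _ hS₀]
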